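/- Let $K$ be a field with $2\ne 0$, let $R=R_0\oplus R_1$ be a supercommutative $\mathbb Z/2$-graded $K$-algebra, and let $0\le r\le n$, $0\le s\le m$. All spaces are described by their $R$-points; column labels are $1,\dots,n$ (even) and $\hat 1,\dots,\hat m$ (odd). *The Grassmannian.* A point $L$ of $G_{r|s}(V)$, $\dim V=n|m$, is a class of even $(r|s)\times(n|m)$ matrices $U$ over $R$ containing an invertible $(r|s)\times(r|s)$ submatrix, modulo $U\sim gU$, $g\in GL(r|s)(R)$. *Berezinians.* For a supermatrix with blocks $M_{00},M_{01},M_{10},M_{11}$, $$\operatorname{Ber}M=\frac{\det(M_{00}-M_{01}M_{11}^{-1}M_{10})}{\det M_{11}},\qquad \operatorname{Ber}^*M=\frac{\det(M_{11}-M_{10}M_{00}^{-1}M_{01})}{\det M_{00}},$$ defined when $M_{11}$, respectively $M_{00}$, is invertible. The first is also used when one column in an even position is odd, the second when one column in an odd position is even (a "ghost" column). *Essential coordinates.* Homogeneous coordinates on the weighted projective superspace $P_{1,-1}$ are: of weight $+1$, $u^{a_1\dots a_r|\hat\mu_1\dots\hat\mu_s}$ (even) and $u^{a_1\dots\hat\nu\dots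 a_r|\hat\mu_1\dots\hat\mu_s}$ (odd; one of the $a_i$ is replaced by $\hat\nu$); of weight $-1$, $u^{*a_1\dots a_r|\hat\mu_1\dots\hat\mu_s}$ (even) and $u^{*a_1\dots a_r|\hat\mu_1\dots b\dots\hat\mu_s}$ (odd; one of the $\hat\mu_\alpha$ is replaced by $b$). They take values in $R$, are antisymmetric in the first $r$ and in the last $s$ indices; the $\hat\mu$'s in $u$ and the $a$'s in $u^*$ are distinct; $u^{\dots\hat\nu\dots|\hat{\underline\mu}}=0$ if $\hat\nu\in\{\hat\mu_\alpha\}$ and $u^{*\underline a|\dots b\dots}=0$ if $b\in\{a_i\}$. Some even $u$ and some even $u^*$ is invertible, and $(u,u^*)\sim(\lambda u,\lambda^{-1}u^*)$ for invertible $\lambda\in R_0$. The super Plücker map $\mathrm{Pl}$ sends the class of $U$ to the class of the family of all $u^{\underline c|\hat{\underline\mu}}=\operatorname{Ber}U^{\underline c|\hat{\underline\mu}}$, $u^{*\underline a|\underline d}=\operatorname{Ber}^*U^{\underline a|\underline d}$, where $U^{\underline c|\underline d}$ is formed by the indicated columns of $U$; its domain consists of the planes for which all these Berezinians and inverse Berezinians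 are defined. **Theorem.** (i) $\mathrm{Pl}$ is well defined on its domain, as a map to the weighted projective superspace. (ii) A point of the weighted projective superspace with homogeneous coordinates $(u,u^*)$ lies in the image of $\mathrm{Pl}$ if and only if the following relations hold for all indices (with $\underline a|\hat{\underline\mu}$ distinct within each group; $\hat\nu_1,\dots,\hat\nu_s$ distinct in (1), (2); $b_1,\dots,b_r$ distinct in (3)), where it is part of each of (1)–(3) that its left-hand side is defined: $$u^{\underline a|\hat{\underline\mu}}\,u^{*\underline a|\hat{\underline\mu}}=1,\tag{0}$$ $$\operatorname{Ber}M^{b_1\dots b_r|\hat\nu_1\dots\hat\nu_s}=(u^{\underline a|\hat{\underline\mu}})^{r+s-1}\,u^{b_1\dots b_r|\hat\nu_1\dots\hat\nu_s},\tag{1}$$ $$\operatorname{Ber}M^{b_1\dots\hat\lambda\dots b_r|\hat\nu_1\dots\hat\nu_s}=(u^{\underline a|\hat{\underline\mu}})^{r+s-1}\,u^{b_1\dots\hat\lambda\dots b_r|\hat\nu_1\dots\hat\nu_s},\tag{2}$$ $$\operatorname{Ber}^*M^{b_1\dots b_r|\hat\nu_1\dots c\dots\hat\nu_s}=(u^{\underline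 a|\hat{\underline\mu}})^{-r-s+1}\,u^{*b_1\dots b_r|\hat\nu_1\dots c\dots\hat\nu_s}.\tag{3}$$ Here $M=M(\underline a|\hat{\underline\mu})$ is the $(r|s)\times(n|m)$ matrix whose column with label $x$ has entries $u^{a_1\dots a_{i-1}\,x\,a_{i+1}\dots a_r|\hat{\underline\mu}}$ ($i=1,\dots,r$) and $u^{*\underline a|\hat\mu_1\dots\hat\mu_{\alpha-1}\,x\,\hat\mu_{\alpha+1}\dots\hat\mu_s}$ ($\alpha=1,\dots,s$), and superscripts on $M$ select columns; in (2) one of the $b_j$ is replaced by an odd label $\hat\lambda$, in (3) one of the $\hat\nu_\beta$ by an even label $c$. (iii) For an arbitrary matrix $U$ of homogeneous coordinates on $G_{r|s}(V)$ and any $\underline a|\hat{\underline\mu}$ with $U^{\underline a|\hat{\underline\mu}}$ invertible, the minors of $U$ satisfy (0), they satisfy (1) and (2) whenever the coordinate of $U$ on the right-hand side is defined (i.e. the odd-odd block of $U^{\underline b|\hat{\underline\nu}}$ is invertible), and (3) whenever the coordinate of $U$ on the right-hand side is defined (i.e. the even-even block of the columns $b_1,\dots,b_r$ is invertible). -/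

import Mathlib

namespace SuperPlucker

universe u v

/-- The sign rule `a b = (-1)^{|a||b|} b a` for homogeneous elements of a `ℤ/2`-graded algebra. -/
def SuperCommutative {K : Type u} {R : Type v} [Field K] [Ring R] [Algebra K R]
    (𝒜 : ZMod 2 → Submodule K R) : Prop :=
  ∀ i j : ZMod 2, ∀ a ∈ 𝒜 i, ∀ b ∈ 𝒜 j, a * b = (-1 : R) ^ (i.val * j.val) * (b * a)

section Ber

variable {R : Type v} [Ring R]

/-- The determinant, with the factors of every product taken in the order of the columns.
It is used for matrices whose entries are even, except that one column may be odd; every product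
then has at most one odd factor, so that the order of the factors does not matter. -/
noncomputable def colDet {k : ℕ} (M : Matrix (Fin k) (Fin k) R) : R :=
  ∑ σ : Equiv.Perm (Fin k), ((Equiv.Perm.sign σ : ℤˣ) : ℤ) •
    (List.ofFn fun j : Fin k => M (σ j) j).prod

/-- The Berezinian `det (M₀₀ - M₀₁ M₁₁⁻¹ M₁₀) / det M₁₁`. The formula is also the extension by
multilinearity in the even columns, so that one column in an even position may be odd. It is
meaningful where `BerDefined M` holds. -/
noncomputable def ber {r s : ℕ} (M : Matrix (Fin r ⊕ Fin s) (Fin r ⊕ Fin s) R) : R :=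
  colDet (M.toBlocks₁₁ - M.toBlocks₁₂ * Ring.inverse M.toBlocks₂₂ * M.toBlocks₂₁) *
    Ring.inverse (colDet M.toBlocks₂₂)

/-- The Berezinian of `M` is defined: the block `M₁₁` by which one divides is invertible. -/
def BerDefined {r s : ℕ} (M : Matrix (Fin r ⊕ Fin s) (Fin r ⊕ Fin s) R) : Prop :=
  IsUnit M.toBlocks₂₂

/-- Parity reversion of a supermatrix: the two blocks of rows, and of columns, trade places. -/
def parityRev {r s : ℕ} (M : Matrix (Fin r ⊕ Fin s) (Fin r ⊕ Fin s) R) :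
    Matrix (Fin s ⊕ Fin r) (Fin s ⊕ Fin r) R :=
  M.submatrix Sum.swap Sum.swap

/-- The inverse Berezinian `Ber* M = Ber M^Π = det (M₁₁ - M₁₀ M₀₀⁻¹ M₀₁) / det M₀₀`. -/
noncomputable def berStar {r s : ℕ} (M : Matrix (Fin r ⊕ Fin s) (Fin r ⊕ Fin s) R) : R :=
  ber (parityRev M)

/-- The inverse Berezinian of `M` is defined: the block `M₀₀` is invertible. -/
def BerStarDefined {r s : ℕ} (M : Matrix (Fin r ⊕ Fin s) (Fin r ⊕ Fin s) R) : Prop :=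
  BerDefined (parityRev M)

open Classical in
/-- Integral powers of an invertible element (and `0` for an element that is not invertible). -/
noncomputable def unitZPow (x : R) (k : ℤ) : R :=
  if h : IsUnit x then ((h.unit ^ k : Rˣ) : R) else 0

end Ber

/-! ### Indices -/

/-- Parity of a row or column label: `inl` is even, `inr` is odd. -/
def labelParity {n m : ℕ} : Fin n ⊕ Fin m → ZMod 2 := Sum.elim (fun _ => 0) (fun _ => 1)

/-- Indices for the `r` even positions: column labels of which at most one is odd (a ghost). -/
def EvenWord (r n m : ℕ) : Type :=
  {c : Fin r → Fin n ⊕ Fin m // ∀ i j, (c i).isRight → (c j).isRight → i = j}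

/-- Indices for the `s` odd positions: column labels of which at most one is even (a ghost). -/
def OddWord (s n m : ℕ) : Type :=
  {d : Fin s → Fin n ⊕ Fin m // ∀ i j, (d i).isLeft → (d j).isLeft → i = j}

/-- `a₁ … a_r`, without ghost. -/
def evenWord {r n : ℕ} (m : ℕ) (a : Fin r → Fin n) : EvenWord r n m :=
  ⟨fun i => Sum.inl (a i), by intro _ _ hi; simp at hi⟩

/-- `μ₁ … μ_s`, without ghost. -/
def oddWord {s m : ℕ} (n : ℕ) (μ : Fin s → Fin m) : OddWord s n m :=
  ⟨fun i => Sum.inr (μ i), by intro _ _ hi; simp at hi⟩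

/-- `a₁ … a_{i-1} x a_{i+1} … a_r`. -/
def evenSubst {r n m : ℕ} (a : Fin r → Fin n) (i : Fin r) (x : Fin n ⊕ Fin m) : EvenWord r n m :=
  ⟨Function.update (fun k => Sum.inl (a k)) i x, by
    have key : ∀ k, (Function.update (fun k => (Sum.inl (a k) : Fin n ⊕ Fin m)) i x k).isRight →
        k = i := by
      intro k hk
      by_contra hne
      rw [Function.update_of_ne hne] at hk
      simp at hk
    intro k l hk hl
    rw [key k hk, key l hl]⟩

/-- `μ₁ … μ_{α-1} x μ_{α+1} … μ_s`. -/
def oddSubst {s n m : ℕ} (μ : Fin s → Fin m) (α : Fin s) (x : Fin n ⊕ Fin m) : OddWord s n m :=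
  ⟨Function.update (fun k => Sum.inr (μ k)) α x, by
    have key : ∀ k, (Function.update (fun k => (Sum.inr (μ k) : Fin n ⊕ Fin m)) α x k).isLeft →
        k = α := by
      intro k hk
      by_contra hne
      rw [Function.update_of_ne hne] at hk
      simp at hk
    intro k l hk hl
    rw [key k hk, key l hl]⟩

/-- Rearrangement of the indices in the even positions. -/
def EvenWord.perm {r n m : ℕ} (c : EvenWord r n m) (σ : Equiv.Perm (Fin r)) : EvenWord r n m :=
  ⟨fun i => c.1 (σ i), fun i j hi hj => σ.injective (c.2 _ _ hi hj)⟩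

/-- Rearrangement of the indices in the odd positions. -/
def OddWord.perm {s n m : ℕ} (d : OddWord s n m) (τ : Equiv.Perm (Fin s)) : OddWord s n m :=
  ⟨fun i => d.1 (τ i), fun i j hi hj => τ.injective (d.2 _ _ hi hj)⟩

section Grassmannian

variable {K : Type u} {R : Type v} [Field K] [Ring R] [Algebra K R]

/-- An even supermatrix: entries in the diagonal blocks are even, in the antidiagonal blocks
odd. -/
def IsEvenMatrix {p q n m : ℕ} (𝒜 : ZMod 2 → Submodule K R)
    (U : Matrix (Fin p ⊕ Fin q) (Fin n ⊕ Fin m) R) : Prop :=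
  ∀ i x, U i x ∈ 𝒜 (labelParity i + labelParity x)

theorem isEvenMatrix_one {p q : ℕ} (𝒜 : ZMod 2 → Submodule K R) [GradedAlgebra 𝒜] :
    IsEvenMatrix 𝒜 (1 : Matrix (Fin p ⊕ Fin q) (Fin p ⊕ Fin q) R) := by
  intro i x
  by_cases h : i = x
  · subst h
    have h0 : labelParity i + labelParity i = 0 := CharTwo.add_self_eq_zero _
    rw [Matrix.one_apply_eq, h0]
    exact SetLike.GradedOne.one_mem
  · rw [Matrix.one_apply_ne h]
    exact Submodule.zero_mem _

theorem IsEvenMatrix.mul {p q p' q' n m : ℕ} {𝒜 : ZMod 2 → Submodule K R} [GradedAlgebra 𝒜]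
    {g : Matrix (Fin p ⊕ Fin q) (Fin p' ⊕ Fin q') R}
    {U : Matrix (Fin p' ⊕ Fin q') (Fin n ⊕ Fin m) R}
    (hg : IsEvenMatrix 𝒜 g) (hU : IsEvenMatrix 𝒜 U) : IsEvenMatrix 𝒜 (g * U) := by
  intro i x
  rw [Matrix.mul_apply]
  refine Submodule.sum_mem _ fun j _ => ?_
  have h := SetLike.GradedMul.mul_mem (hg i j) (hU j x)
  have e : labelParity i + labelParity j + (labelParity j + labelParity x)
      = labelParity i + labelParity x := by
    have : labelParity j + labelParity j = 0 := CharTwo.add_self_eq_zero _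
    linear_combination this
  rwa [e] at h

/-- The square matrix formed by the columns `c₁ … c_r | d₁ … d_s` of `U`. -/
def cols {p q n m r s : ℕ} (U : Matrix (Fin p ⊕ Fin q) (Fin n ⊕ Fin m) R)
    (c : Fin r → Fin n ⊕ Fin m) (d : Fin s → Fin n ⊕ Fin m) :
    Matrix (Fin p ⊕ Fin q) (Fin r ⊕ Fin s) R :=
  U.submatrix id (Sum.elim c d)

/-- The submatrix `U^{a₁ … a_r | μ₁ … μ_s}`. -/
def minorMatrix {p q n m r s : ℕ} (U : Matrix (Fin p ⊕ Fin q) (Fin n ⊕ Fin m) R)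
    (a : Fin r → Fin n) (μ : Fin s → Fin m) : Matrix (Fin p ⊕ Fin q) (Fin r ⊕ Fin s) R :=
  cols U (evenWord m a).1 (oddWord n μ).1

/-- The `R`-points of the Stiefel superspace `St_{r|s}`: matrices of homogeneous coordinates, i.e.
even `r|s × n|m` matrices of rank `r|s` (they contain an invertible `r|s × r|s` submatrix). -/
def Stiefel (r s n m : ℕ) (𝒜 : ZMod 2 → Submodule K R) : Type v :=
  {U : Matrix (Fin r ⊕ Fin s) (Fin n ⊕ Fin m) R // IsEvenMatrix 𝒜 U ∧
    ∃ (a : Fin r ↪ Fin n) (μ : Fin s ↪ Fin m), IsUnit (minorMatrix U a μ)}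

/-- `U ∼ g U` with `g ∈ GL(r|s)`, an even invertible matrix over `R`. -/
def stiefelSetoid (r s n m : ℕ) (𝒜 : ZMod 2 → Submodule K R) [GradedAlgebra 𝒜] :
    Setoid (Stiefel r s n m 𝒜) where
  r U U' := ∃ g h : Matrix (Fin r ⊕ Fin s) (Fin r ⊕ Fin s) R,
    IsEvenMatrix 𝒜 g ∧ IsEvenMatrix 𝒜 h ∧ g * h = 1 ∧ h * g = 1 ∧ U'.1 = g * U.1
  iseqv :=
    { refl := fun U => ⟨1, 1, isEvenMatrix_one 𝒜, isEvenMatrix_one 𝒜, one_mul 1, one_mul 1,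
        (Matrix.one_mul _).symm⟩
      symm := by
        rintro U U' ⟨g, h, hg, hh, h1, h2, e⟩
        exact ⟨h, g, hh, hg, h2, h1, by rw [e, ← Matrix.mul_assoc, h2, Matrix.one_mul]⟩
      trans := by
        rintro U U' U'' ⟨g, h, hg, hh, h1, h2, e⟩ ⟨g', h', hg', hh', h1', h2', e'⟩
        refine ⟨g' * g, h * h', hg'.mul hg, hh.mul hh', ?_, ?_, ?_⟩
        · rw [Matrix.mul_assoc, ← Matrix.mul_assoc g, h1, Matrix.one_mul, h1']
        · rw [Matrix.mul_assoc, ← Matrix.mul_assoc h', h2', Matrix.one_mul, h2]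
        · rw [e', e, Matrix.mul_assoc] }

/-- The `R`-points of the super Grassmannian `G_{r|s}(V) = St_{r|s}(V) / GL(r|s)`,
`dim V = n|m`. -/
def Grassmannian (r s n m : ℕ) (𝒜 : ZMod 2 → Submodule K R) [GradedAlgebra 𝒜] : Type v :=
  Quotient (stiefelSetoid r s n m 𝒜)

end Grassmannian

/-! ### Essential super Plücker coordinates -/

/-- A family of values for the essential coordinates: `u c μ` is `u^{c|μ}` and `us a d` is
`u^{*a|d}`, where `c` and `d` may each contain one ghost index. The indices `μ` of `u` and the
indices `a` of `us` are pairwise distinct. -/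
@[ext]
structure EssFamily (r s n m : ℕ) (R : Type v) where
  u : EvenWord r n m → (Fin s ↪ Fin m) → R
  us : (Fin r ↪ Fin n) → OddWord s n m → R

section Pfin

variable {K : Type u} {R : Type v} [Field K] [Ring R] [Algebra K R]

/-- The formal properties of homogeneous coordinates of a point of the weighted projective
superspace. -/
structure IsHomogCoord {r s n m : ℕ} (𝒜 : ZMod 2 → Submodule K R) (z : EssFamily r s n m R) :
    Prop where
  u_parity : ∀ c μ, z.u c μ ∈ 𝒜 (∑ i, labelParity (c.1 i))
  u_antisymm_even : ∀ c μ (σ : Equiv.Perm (Fin r)),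
    z.u (c.perm σ) μ = ((Equiv.Perm.sign σ : ℤˣ) : ℤ) • z.u c μ
  u_antisymm_odd : ∀ c μ (τ : Equiv.Perm (Fin s)),
    z.u c (τ.toEmbedding.trans μ) = ((Equiv.Perm.sign τ : ℤˣ) : ℤ) • z.u c μ
  u_ghost : ∀ c (μ : Fin s ↪ Fin m) i α, c.1 i = Sum.inr (μ α) → z.u c μ = 0
  us_parity : ∀ a d, z.us a d ∈ 𝒜 (∑ α, (labelParity (d.1 α) + 1))
  us_antisymm_even : ∀ a d (σ : Equiv.Perm (Fin r)),
    z.us (σ.toEmbedding.trans a) d = ((Equiv.Perm.sign σ : ℤˣ) : ℤ) • z.us a d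
  us_antisymm_odd : ∀ a d (τ : Equiv.Perm (Fin s)),
    z.us a (d.perm τ) = ((Equiv.Perm.sign τ : ℤˣ) : ℤ) • z.us a d
  us_ghost : ∀ (a : Fin r ↪ Fin n) d α i, d.1 α = Sum.inl (a i) → z.us a d = 0
  /-- The part of weight `+1` does not vanish: an even coordinate in it is invertible. -/
  u_ne_zero : ∃ (a : Fin r ↪ Fin n) (μ : Fin s ↪ Fin m), IsUnit (z.u (evenWord m a) μ)
  /-- The part of weight `-1` does not vanish: an even coordinate in it is invertible. -/
  us_ne_zero : ∃ (a : Fin r ↪ Fin n) (μ : Fin s ↪ Fin m), IsUnit (z.us a (oddWord n μ))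

/-- Homogeneous coordinates (over `R`) of points of the weighted projective superspace. -/
def PfinVec (r s n m : ℕ) (𝒜 : ZMod 2 → Submodule K R) : Type v :=
  {z : EssFamily r s n m R // IsHomogCoord 𝒜 z}

/-- Weighted rescaling `(u, u*) ∼ (l u, l⁻¹ u*)` by even invertible `l`. (Even elements are central,
so the side on which `l⁻¹` stands does not matter.) -/
def pfinSetoid (r s n m : ℕ) (𝒜 : ZMod 2 → Submodule K R) [GradedAlgebra 𝒜] :
    Setoid (PfinVec r s n m 𝒜) where
  r z z' := ∃ l : Rˣ, (l : R) ∈ 𝒜 0 ∧ ((l⁻¹ : Rˣ) : R) ∈ 𝒜 0 ∧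
    (∀ c μ, z'.1.u c μ = (l : R) * z.1.u c μ) ∧
    (∀ a d, z'.1.us a d = z.1.us a d * ((l⁻¹ : Rˣ) : R))
  iseqv :=
    { refl := fun z => ⟨1, by simpa using SetLike.GradedOne.one_mem,
        by simpa using SetLike.GradedOne.one_mem, by simp, by simp⟩
      symm := by
        rintro z z' ⟨l, h1, h2, hu, hs⟩
        exact ⟨l⁻¹, h2, by simpa using h1, fun c μ => by rw [hu]; simp,
          fun a d => by rw [hs]; simp⟩
      trans := by
        rintro z z' z'' ⟨l, h1, h2, hu, hs⟩ ⟨l', h1', h2', hu', hs'⟩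
        have hm : ∀ a b : R, a ∈ 𝒜 0 → b ∈ 𝒜 0 → a * b ∈ 𝒜 0 := fun a b ha hb => by
          simpa using SetLike.GradedMul.mul_mem ha hb
        refine ⟨l' * l, ?_, ?_, fun c μ => ?_, fun a d => ?_⟩
        · simpa using hm _ _ h1' h1
        · rw [mul_inv_rev]; simpa using hm _ _ h2 h2'
        · rw [hu', hu, Units.val_mul, mul_assoc]
        · rw [hs', hs, mul_inv_rev, Units.val_mul, mul_assoc] }

/-- The `R`-points of the weighted projective superspace of essential coordinates, with weights
`+1` for `u` and `-1` for `u*` (those points that lie in its standard affine charts; if `R` is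
local, these are all `R`-points). -/
def Pfin (r s n m : ℕ) (𝒜 : ZMod 2 → Submodule K R) [GradedAlgebra 𝒜] : Type v :=
  Quotient (pfinSetoid r s n m 𝒜)

/-! ### The super Plücker map -/

/-- The minors and wrong minors of `U`: `u^{c|μ} = Ber U^{c|μ}` and `u^{*a|d} = Ber* U^{a|d}`. -/
noncomputable def plCoord {r s n m : ℕ} (U : Matrix (Fin r ⊕ Fin s) (Fin n ⊕ Fin m) R) :
    EssFamily r s n m R where
  u c μ := ber (cols U c.1 (oddWord n μ).1)
  us a d := berStar (cols U (evenWord m a).1 d.1)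

/-- All the Berezinians and inverse Berezinians that give the coordinates of `U` are defined. -/
def IsRegular {r s n m : ℕ} (U : Matrix (Fin r ⊕ Fin s) (Fin n ⊕ Fin m) R) : Prop :=
  (∀ (c : EvenWord r n m) (μ : Fin s ↪ Fin m), BerDefined (cols U c.1 (oddWord n μ).1)) ∧
  (∀ (a : Fin r ↪ Fin n) (d : OddWord s n m), BerStarDefined (cols U (evenWord m a).1 d.1))

/-- The domain of the super Plücker map: the planes at which all essential coordinates are
defined. -/
def InDomain {r s n m : ℕ} {𝒜 : ZMod 2 → Submodule K R} [GradedAlgebra 𝒜]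
    (L : Grassmannian r s n m 𝒜) : Prop :=
  ∃ U : Stiefel r s n m 𝒜, Quotient.mk _ U = L ∧ IsRegular U.1

/-- The graph of the super Plücker map: `L` is in the domain and is sent to `p`, the class of the
coordinates of a matrix `U` that represents `L`. -/
def IsPl {r s n m : ℕ} {𝒜 : ZMod 2 → Submodule K R} [GradedAlgebra 𝒜]
    (L : Grassmannian r s n m 𝒜) (p : Pfin r s n m 𝒜) : Prop :=
  ∃ U : Stiefel r s n m 𝒜, Quotient.mk _ U = L ∧ IsRegular U.1 ∧
    ∃ z : PfinVec r s n m 𝒜, Quotient.mk _ z = p ∧ z.1 = plCoord U.1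

end Pfin

/-! ### The relations -/

section Relations

variable {R : Type v} [Ring R] {r s n m : ℕ}

/-- The `r|s × n|m` matrix whose column with label `x` has the entries
`u^{a₁ … a_{i-1} x a_{i+1} … a_r | μ}` (`i = 1, …, r`) and
`u^{*a | μ₁ … μ_{α-1} x μ_{α+1} … μ_s}` (`α = 1, …, s`). -/
def essMatrix (z : EssFamily r s n m R) (a : Fin r ↪ Fin n) (μ : Fin s ↪ Fin m) :
    Matrix (Fin r ⊕ Fin s) (Fin n ⊕ Fin m) R :=
  Matrix.of fun row x =>
    Sum.elim (fun i => z.u (evenSubst a i x) μ) (fun α => z.us a (oddSubst μ α x)) row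

/-- `u^{a|μ} u^{*a|μ} = 1`. -/
def Rel0 (z : EssFamily r s n m R) (a : Fin r ↪ Fin n) (μ : Fin s ↪ Fin m) : Prop :=
  z.u (evenWord m a) μ * z.us a (oddWord n μ) = 1

/-- `Ber (essMatrix, columns b₁ … b_r | ν₁ … ν_s) = (u^{a|μ})^{r+s-1} u^{b|ν}`, where the left side
is defined. -/
def Rel1 (z : EssFamily r s n m R) (a : Fin r ↪ Fin n) (μ : Fin s ↪ Fin m)
    (b : Fin r → Fin n) (ν : Fin s ↪ Fin m) : Prop :=
  BerDefined (cols (essMatrix z a μ) (evenWord m b).1 (oddWord n ν).1) ∧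
  ber (cols (essMatrix z a μ) (evenWord m b).1 (oddWord n ν).1) =
    unitZPow (z.u (evenWord m a) μ) ((r : ℤ) + s - 1) * z.u (evenWord m b) ν

/-- The same with an odd (ghost) label `l` in the `k`-th even position (in place of `b_k`). -/
def Rel2 (z : EssFamily r s n m R) (a : Fin r ↪ Fin n) (μ : Fin s ↪ Fin m)
    (b : Fin r → Fin n) (k : Fin r) (l : Fin m) (ν : Fin s ↪ Fin m) : Prop :=
  BerDefined (cols (essMatrix z a μ) (evenSubst b k (Sum.inr l)).1 (oddWord n ν).1) ∧
  ber (cols (essMatrix z a μ) (evenSubst b k (Sum.inr l)).1 (oddWord n ν).1) =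
    unitZPow (z.u (evenWord m a) μ) ((r : ℤ) + s - 1) * z.u (evenSubst b k (Sum.inr l)) ν

/-- `Ber* (essMatrix, columns b₁ … b_r | ν₁ … c … ν_s) = (u^{a|μ})^{-r-s+1} u^{*b|ν₁ … c … ν_s}`,
with an even (ghost) label `c` in the `k`-th odd position (in place of `ν_k`), where the left side is
defined. -/
def Rel3 (z : EssFamily r s n m R) (a : Fin r ↪ Fin n) (μ : Fin s ↪ Fin m)
    (b : Fin r ↪ Fin n) (ν : Fin s → Fin m) (k : Fin s) (c : Fin n) : Prop :=
  BerStarDefined (cols (essMatrix z a μ) (evenWord m b).1 (oddSubst ν k (Sum.inl c)).1) ∧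
  berStar (cols (essMatrix z a μ) (evenWord m b).1 (oddSubst ν k (Sum.inl c)).1) =
    unitZPow (z.u (evenWord m a) μ) (-(r : ℤ) - s + 1) * z.us b (oddSubst ν k (Sum.inl c))

/-- The super Plücker relations, for all choices of indices. -/
structure SuperPluckerRelations (z : EssFamily r s n m R) : Prop where
  rel0 : ∀ a μ, Rel0 z a μ
  rel1 : ∀ a μ b ν, Rel1 z a μ b ν
  rel2 : ∀ a μ b k l ν, Rel2 z a μ b k l ν
  rel3 : ∀ a μ b ν k c, Rel3 z a μ b ν k c

end Relations

end SuperPlucker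

/-! Everything follows from `Ber (g M) = Ber g · Ber M` for an invertible even `g`, where the
columns of `M` in even positions are arbitrary, so that a ghost is allowed. Its source is the
identity `det (1 + T C) · det (1 + C T) = 1` for odd matrices `T`, `C` (`OddPart.det_mul_det`), with
determinants over the commutative ring `E` of even elements. The same identity gives `Ber g · Ber* g
= 1`.

Well-definedness: passing from `U` to `g U` multiplies the `u` by `Ber g` and the `u*` by `Ber* g =
(Ber g)⁻¹`.

Relations for the minors: let `A` be the invertible submatrix `a|μ` of `U`, and let `W = A⁻¹ U`,
which has the identity in these columns. The super Cramer rule says that the entries of the matrix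
`M` of the relations are those of `W`, multiplied by `y = Ber A` in even rows and by `y⁻¹` in odd
rows. Thus `M = G U` with `G = D A⁻¹`, `D` block diagonal with entries `y` and `y⁻¹`, `Ber D =
y^(r+s)`, and hence `Ber G = y^(r+s-1)`. The relations are multiplicativity of `Ber` and `Ber*`
applied to `G U` (`exists_essMatrix_eq`, `relations_of_rescaled`).

Converse: if the relations hold, the matrix `M` built from `(u, u*)` at some `a|μ` with `u^{a|μ}`
invertible is itself a matrix of homogeneous coordinates of the required plane. By the relations its
minors are `l u` and `l⁻¹ u*` with `l = (u^{a|μ})^(r+s-1)` (`exists_isPl_of_relations`). -/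

namespace SuperPlucker

universe u v

set_option linter.unusedSectionVars false

/-! ### The ordered determinant over a central subalgebra -/

section ColDet

variable {E : Type*} {R : Type v} [CommRing E] [Ring R] [Algebra E R] {k : ℕ}

theorem colDet_map (X : Matrix (Fin k) (Fin k) E) :
    colDet (X.map (algebraMap E R)) = algebraMap E R X.det := by
  simp only [colDet, Matrix.map_apply, Matrix.det_apply, map_sum, Units.smul_def, map_zsmul]
  refine Finset.sum_congr rfl fun σ _ => ?_
  have h : ∏ i, X (σ i) i = (List.ofFn fun i => X (σ i) i).prod := List.prod_ofFn.symm
  rw [h, map_list_prod, List.map_ofFn]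
  rfl

theorem colDet_one : colDet (1 : Matrix (Fin k) (Fin k) R) = 1 := by
  have h := colDet_map (R := R) (1 : Matrix (Fin k) (Fin k) ℤ)
  rwa [Matrix.map_one _ (map_zero _) (map_one _), Matrix.det_one, map_one] at h

theorem prod_ofFn_sum_smul (X : Matrix (Fin k) (Fin k) E) (S : Matrix (Fin k) (Fin k) R)
    (σ : Fin k → Fin k) :
    (List.ofFn fun j => ∑ i, X (σ j) i • S i j).prod =
      ∑ f : Fin k → Fin k, (∏ j, X (σ j) (f j)) • (List.ofFn fun j => S (f j) j).prod := by
  have h := (MultilinearMap.mkPiAlgebraFin E k R).map_sum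
    (fun j i => X (σ j) i • S i j)
  simp only [MultilinearMap.map_smul_univ, MultilinearMap.mkPiAlgebraFin_apply] at h
  exact h

/-- The classical expansion of the determinant of a product survives because the entries of `X` are
central and leave the ordered products. Nothing is asked of `S`: the terms of non-injective `f`
vanish through a repeated column of `X`. -/
theorem colDet_map_mul (X : Matrix (Fin k) (Fin k) E) (S : Matrix (Fin k) (Fin k) R) :
    colDet (X.map (algebraMap E R) * S) = algebraMap E R X.det * colDet S := by
  have key : ∀ f : Fin k → Fin k, (∑ σ : Equiv.Perm (Fin k),
      ((Equiv.Perm.sign σ : ℤˣ) : ℤ) • ∏ j, X (σ j) (f j)) = (X.submatrix id f).det := by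
    intro f
    simp [Matrix.det_apply, Units.smul_def]
  have e1 : colDet (X.map (algebraMap E R) * S) = ∑ f : Fin k → Fin k,
      (X.submatrix id f).det • (List.ofFn fun j => S (f j) j).prod := by
    simp only [colDet, Matrix.mul_apply, Matrix.map_apply, ← Algebra.smul_def, prod_ofFn_sum_smul,
      Finset.smul_sum, ← key, Finset.sum_smul, smul_assoc]
    exact Finset.sum_comm
  rw [e1, ← Finset.sum_subset (Finset.filter_subset (fun f => Function.Bijective f) Finset.univ)]
  · rw [← Algebra.smul_def, colDet, Finset.smul_sum]
    refine Finset.sum_bij (fun f hf => Equiv.ofBijective f (Finset.mem_filter.1 hf).2)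
      (fun _ _ => Finset.mem_univ _) (fun _ _ _ _ h => by injection h)
      (fun b _ => ⟨b, Finset.mem_filter.2 ⟨Finset.mem_univ _, b.bijective⟩, DFunLike.coe_injective rfl⟩) ?_
    intro f hf
    have := Matrix.det_permute' (Equiv.ofBijective f (Finset.mem_filter.1 hf).2) X
    rw [Equiv.coe_ofBijective] at this
    rw [this]
    simp [Algebra.smul_def, mul_assoc, (Algebra.commutes _ _).symm]
  · intro f _ hf
    have hf' : ¬ Function.Injective f := fun h =>
      hf (Finset.mem_filter.2 ⟨Finset.mem_univ _, Finite.injective_iff_bijective.1 h⟩)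
    rw [Function.not_injective_iff] at hf'
    obtain ⟨i, j, hij, hne⟩ := hf'
    rw [Matrix.det_zero_of_column_eq hne (fun l => by simp [hij]), zero_smul]

theorem colDet_eq_zero_of_col {M : Matrix (Fin k) (Fin k) R} (j : Fin k) (h : ∀ i, M i j = 0) :
    colDet M = 0 := by
  refine Finset.sum_eq_zero fun σ _ => ?_
  have h0 := (MultilinearMap.mkPiAlgebraFin ℤ k R).map_coord_zero (m := fun j => M (σ j) j) j (h _)
  rw [MultilinearMap.mkPiAlgebraFin_apply] at h0
  rw [h0, smul_zero]

/-- Columns can be permuted in the ordered determinant if all columns but one are central. -/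
theorem colDet_perm (M : Matrix (Fin k) (Fin k) R) (hM : ∀ i j i' j', j ≠ j' →
    Commute (M i j) (M i' j')) (σ : Equiv.Perm (Fin k)) :
    colDet (M.submatrix id σ) = ((Equiv.Perm.sign σ : ℤˣ) : ℤ) • colDet M := by
  have hprod : ∀ τ : Equiv.Perm (Fin k),
      (List.ofFn fun j => M ((τ * σ⁻¹ * σ) j) (σ j)).prod =
        (List.ofFn fun j => M ((τ * σ⁻¹) j) j).prod := by
    intro τ
    have e : (List.ofFn fun j => M ((τ * σ⁻¹ * σ) j) (σ j)) =
        List.ofFn ((fun j => M ((τ * σ⁻¹) j) j) ∘ σ) := rfl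
    rw [e]
    refine List.Perm.prod_eq' (Equiv.Perm.ofFn_comp_perm σ _) ?_
    rw [List.pairwise_ofFn]
    intro i j hij
    exact hM _ _ _ _ fun h => hij.ne (σ.injective h)
  simp only [colDet, Finset.smul_sum, Matrix.submatrix_apply, id]
  refine Fintype.sum_equiv (Equiv.mulRight σ⁻¹) _ _ fun τ => ?_
  have hp := hprod τ
  rw [inv_mul_cancel_right] at hp
  rw [Equiv.coe_mulRight, hp, smul_smul]
  congr 1
  rw [← Units.val_mul, ← Equiv.Perm.sign_mul, Equiv.Perm.sign_mul, Equiv.Perm.sign_mul,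
    Equiv.Perm.sign_inv, mul_comm (Equiv.Perm.sign τ), ← mul_assoc, Int.units_mul_self, one_mul]

theorem prod_ofFn_ite_eq {A : Type*} [Monoid A] {k : ℕ} (i : Fin k) (x : A) :
    (List.ofFn fun j => if j = i then x else 1).prod = x := by
  induction k with
  | zero => exact i.elim0
  | succ k ih =>
    rw [List.ofFn_succ, List.prod_cons]
    cases i using Fin.cases with
    | zero => simp [Fin.succ_ne_zero]
    | succ i => simp [Fin.succ_inj, ih, (Fin.succ_ne_zero i).symm]

theorem colDet_updateCol_one (i : Fin k) (w : Fin k → R) :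
    colDet ((1 : Matrix (Fin k) (Fin k) R).updateCol i w) = w i := by
  rw [colDet, Finset.sum_eq_single 1]
  · have : (fun j => (1 : Matrix (Fin k) (Fin k) R).updateCol i w
        ((1 : Equiv.Perm (Fin k)) j) j) = fun j => if j = i then w i else 1 := by
      funext j
      by_cases h : j = i
      · subst h; simp
      · simp [h]
    rw [this, prod_ofFn_ite_eq]
    simp
  · intro σ _ hσ
    -- A permutation that moves `i` also moves `σ i`, so `σ ≠ 1` moves some point other than `i`;
    -- there the product has an off-diagonal entry of the identity as a factor.
    obtain ⟨j, hj, hji⟩ : ∃ j, σ j ≠ j ∧ j ≠ i := by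
      by_contra! hcon
      apply hσ
      ext j
      by_cases hji : j = i
      · by_contra hne
        have h1 : σ j ≠ j := fun h => hne (by rw [h]; rfl)
        have h2 : σ (σ j) ≠ σ j := fun h => h1 (σ.injective h)
        exact h1 (by rw [hcon _ h2, hji])
      · by_contra hne
        exact hji (hcon j fun h => hne (by rw [h]; rfl))
    have h0 := (MultilinearMap.mkPiAlgebraFin ℤ k R).map_coord_zero
      (m := fun j => (1 : Matrix (Fin k) (Fin k) R).updateCol i w (σ j) j) j
      (by rw [Matrix.updateCol_ne hji, Matrix.one_apply_ne hj])
    rw [MultilinearMap.mkPiAlgebraFin_apply] at h0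
    rw [h0, smul_zero]
  · simp

end ColDet

/-! ### Odd matrices over an algebra with an even and an odd part -/

/-- An odd part `odd` of an algebra `R` over the commutative ring `E` of its even elements, with a
linear projection of `R` onto `E`. -/
structure OddPart (E : Type u) (R : Type v) [CommRing E] [Ring R] [Algebra E R] where
  odd : Submodule E R
  retr : R →ₗ[E] E
  retr_algebraMap : ∀ e, retr (algebraMap E R e) = e
  algebraMap_retr_mul : ∀ x ∈ odd, ∀ y ∈ odd, algebraMap E R (retr (x * y)) = x * y
  anticomm : ∀ x ∈ odd, ∀ y ∈ odd, x * y = -(y * x)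
  mul_self : ∀ x ∈ odd, x * x = 0

section Odd

variable {E : Type u} {R : Type v} [CommRing E] [Ring R] [Algebra E R]
variable {p q t : Type*} [Fintype p] [Fintype q] [Fintype t]
  [DecidableEq p] [DecidableEq q] [DecidableEq t]

/-- A matrix over `E`, regarded as a matrix over `R`. -/
def up (R : Type v) [Ring R] [Algebra E R] (X : Matrix p q E) : Matrix p q R := X.map (algebraMap E R)

@[simp]
theorem up_apply (X : Matrix p q E) (i : p) (j : q) :
    (up R X : Matrix p q R) i j = algebraMap E R (X i j) := rfl

theorem colDet_up {k : ℕ} (X : Matrix (Fin k) (Fin k) E) :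
    colDet (up R X : Matrix _ _ R) = algebraMap E R X.det := colDet_map X

theorem colDet_up_mul {k : ℕ} (X : Matrix (Fin k) (Fin k) E) (S : Matrix (Fin k) (Fin k) R) :
    colDet (up R X * S) = algebraMap E R X.det * colDet S := colDet_map_mul X S

theorem up_mul (X : Matrix p q E) (Y : Matrix q t E) :
    (up R (X * Y) : Matrix p t R) = up R X * up R Y := Matrix.map_mul

theorem up_add (X Y : Matrix p q E) : (up R (X + Y) : Matrix p q R) = up R X + up R Y :=
  by
  ext; simp

theorem up_one : (up R (1 : Matrix p p E) : Matrix p p R) = 1 :=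
  Matrix.map_one _ (map_zero _) (map_one _)

theorem up_inv_mul {X : Matrix p p E} (h : IsUnit X.det) : (up R X⁻¹ : Matrix p p R) * up R X = 1 := by
  rw [← up_mul, Matrix.nonsing_inv_mul _ h, up_one]

theorem up_mul_inv {X : Matrix p p E} (h : IsUnit X.det) : (up R X : Matrix p p R) * up R X⁻¹ = 1 := by
  rw [← up_mul, Matrix.mul_nonsing_inv _ h, up_one]

theorem isUnit_up {X : Matrix p p E} (h : IsUnit X.det) : IsUnit (up R X : Matrix p p R) :=
  ⟨⟨up R X, up R X⁻¹, up_mul_inv h, up_inv_mul h⟩, rfl⟩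

theorem ringInverse_eq {A : Type*} [MonoidWithZero A] {x y : A} (h1 : x * y = 1) (h2 : y * x = 1) :
    Ring.inverse x = y :=
  Ring.inverse_unit ⟨x, y, h1, h2⟩

theorem inverse_up {X : Matrix p p E} (h : IsUnit X.det) :
    Ring.inverse (up R X : Matrix p p R) = up R X⁻¹ :=
  ringInverse_eq (up_mul_inv h) (up_inv_mul h)

namespace OddPart

variable (P : OddPart E R)

/-- All entries of the matrix are odd. -/
def IsOdd (T : Matrix p q R) : Prop := ∀ i j, T i j ∈ P.odd

/-- The projection of a matrix to even entries. -/
def ev (T : Matrix p q R) : Matrix p q E := T.map P.retr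

@[simp]
theorem ev_apply (T : Matrix p q R) (i : p) (j : q) : P.ev T i j = P.retr (T i j) := rfl

theorem ev_up (X : Matrix p q E) : P.ev (up R X) = X := by
  ext i j; exact P.retr_algebraMap _

theorem ev_add (T T' : Matrix p q R) : P.ev (T + T') = P.ev T + P.ev T' := by
  ext i j; simp [ev]

theorem ev_up_mul (X : Matrix p q E) (T : Matrix q t R) : P.ev (up R X * T) = X * P.ev T := by
  ext i j
  simp [ev, Matrix.mul_apply, ← Algebra.smul_def]

theorem ev_mul_up (T : Matrix p q R) (X : Matrix q t E) : P.ev (T * up R X) = P.ev T * X := by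
  ext i j
  simp only [Matrix.mul_apply, ev_apply, up_apply, map_sum]
  refine Finset.sum_congr rfl fun k _ => ?_
  rw [← Algebra.commutes, ← Algebra.smul_def, map_smul, smul_eq_mul, mul_comm]

variable {P}

theorem IsOdd.up_mul {T : Matrix q t R} (hT : P.IsOdd T) (X : Matrix p q E) :
    P.IsOdd (up R X * T) := by
  intro i j
  rw [Matrix.mul_apply]
  refine Submodule.sum_mem _ fun k _ => ?_
  rw [up_apply, ← Algebra.smul_def]
  exact P.odd.smul_mem _ (hT _ _)

theorem IsOdd.mul_up {T : Matrix p q R} (hT : P.IsOdd T) (X : Matrix q t E) :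
    P.IsOdd (T * up R X) := by
  intro i j
  rw [Matrix.mul_apply]
  refine Submodule.sum_mem _ fun k _ => ?_
  rw [up_apply, ← Algebra.commutes, ← Algebra.smul_def]
  exact P.odd.smul_mem _ (hT _ _)

theorem IsOdd.add {T T' : Matrix p q R} (hT : P.IsOdd T) (hT' : P.IsOdd T') : P.IsOdd (T + T') :=
  fun i j => P.odd.add_mem (hT i j) (hT' i j)

theorem IsOdd.neg {T : Matrix p q R} (hT : P.IsOdd T) : P.IsOdd (-T) :=
  fun i j => P.odd.neg_mem (hT i j)

/-- Products of odd elements are even, so the projection loses nothing. This allows determinants of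
expressions in `T * C` to be taken over `E`. -/
theorem IsOdd.up_ev {T : Matrix p q R} {C : Matrix q t R} (hT : P.IsOdd T) (hC : P.IsOdd C) :
    up R (P.ev (T * C)) = T * C := by
  ext i j
  simp only [up_apply, ev_apply, Matrix.mul_apply, map_sum]
  exact Finset.sum_congr rfl fun k _ => P.algebraMap_retr_mul _ (hT _ _) _ (hC _ _)

theorem IsOdd.up_one_add {T : Matrix p q R} {C : Matrix q p R} (hT : P.IsOdd T) (hC : P.IsOdd C) :
    up R (1 + P.ev (T * C)) = 1 + T * C := by
  rw [up_add, up_one, hT.up_ev hC]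

/-! ### The determinants of `1 + T C` and `1 + C T` -/

theorem det_one_add_vecMulVec (a b : p → E) :
    (1 + Matrix.vecMulVec a b).det = 1 + b ⬝ᵥ a := by
  rw [← Matrix.det_one_add_replicateCol_mul_replicateRow (ι := Unit), Matrix.vecMulVec_eq Unit]

/-- Both products have a single nonzero column or row, so with `ε = c T i j` the two determinants
are `1 - ε` and `1 + ε`, and `ε² = 0` because `c² = 0`. -/
theorem det_mul_det_single {T : Matrix p q R} (hT : P.IsOdd T) (j : q) (i : p) {c : R}
    (hc : c ∈ P.odd) :
    (1 + P.ev (T * Matrix.single j i c)).det * (1 + P.ev (Matrix.single j i c * T)).det = 1 := by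
  have e1 : P.ev (T * Matrix.single j i c) =
      Matrix.vecMulVec (fun k => P.retr (T k j * c)) (Pi.single i 1) := by
    ext k l
    by_cases h : l = i
    · subst h; simp [ev, Matrix.vecMulVec_apply]
    · simp [ev, Matrix.vecMulVec_apply, h]
  have e2 : P.ev (Matrix.single j i c * T) =
      Matrix.vecMulVec (Pi.single j 1) (fun k => P.retr (c * T i k)) := by
    ext k l
    by_cases h : k = j
    · subst h; simp [ev, Matrix.vecMulVec_apply]
    · simp [ev, Matrix.vecMulVec_apply, h]
  rw [e1, e2, det_one_add_vecMulVec, det_one_add_vecMulVec, single_one_dotProduct,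
    dotProduct_single_one, P.anticomm _ (hT i j) _ hc, map_neg]
  have hsq : P.retr (c * T i j) * P.retr (c * T i j) = 0 := by
    have hz : c * T i j * (c * T i j) = 0 := by
      nth_rewrite 1 [P.anticomm _ hc _ (hT i j)]
      rw [neg_mul, mul_assoc, ← mul_assoc c, P.mul_self _ hc, zero_mul, mul_zero, neg_zero]
    rw [← smul_eq_mul, ← map_smul, Algebra.smul_def, P.algebraMap_retr_mul _ hc _ (hT i j), hz,
      map_zero]
  linear_combination -hsq

/-- With `X = 1 + T C` and `Y = 1 + C T` one has `X T = T Y`, whence `1 + T (C + C') = X (1 + X⁻¹ T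
C')` and `1 + (C + C') T = (1 + C' X⁻¹ T) Y`. The property of `C'` is then needed at `X⁻¹ T` instead
of `T`. -/
theorem det_mul_det_add {C C' : Matrix q p R} (hC : P.IsOdd C)
    (h : ∀ T : Matrix p q R, P.IsOdd T → (1 + P.ev (T * C)).det * (1 + P.ev (C * T)).det = 1)
    (h' : ∀ T : Matrix p q R, P.IsOdd T → (1 + P.ev (T * C')).det * (1 + P.ev (C' * T)).det = 1)
    (T : Matrix p q R) (hT : P.IsOdd T) :
    (1 + P.ev (T * (C + C'))).det * (1 + P.ev ((C + C') * T)).det = 1 := by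
  set X := 1 + P.ev (T * C) with hX
  set Y := 1 + P.ev (C * T) with hY
  have hXY : X.det * Y.det = 1 := h T hT
  have uX : IsUnit X.det := IsUnit.of_mul_eq_one _ hXY
  have hupX : (up R X : Matrix p p R) = 1 + T * C := hT.up_one_add hC
  have hupY : (up R Y : Matrix q q R) = 1 + C * T := hC.up_one_add hT
  have hT' : P.IsOdd (up R X⁻¹ * T) := hT.up_mul _
  have e1 : 1 + P.ev (T * (C + C')) = X * (1 + P.ev (up R X⁻¹ * T * C')) := by
    rw [Matrix.mul_assoc, ev_up_mul, mul_add, mul_one, ← Matrix.mul_assoc,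
      Matrix.mul_nonsing_inv _ uX, Matrix.one_mul, Matrix.mul_add, ev_add, hX, add_assoc]
  have e2 : 1 + P.ev ((C + C') * T) = (1 + P.ev (C' * (up R X⁻¹ * T))) * Y := by
    have : C' * (up R X⁻¹ * T) * up R Y = C' * T := by
      have hTY : T * up R Y = up R X * T := by
        rw [hupX, hupY, Matrix.mul_add, Matrix.add_mul, Matrix.mul_one, Matrix.one_mul,
          Matrix.mul_assoc]
      rw [Matrix.mul_assoc, Matrix.mul_assoc, hTY, ← Matrix.mul_assoc (up R X⁻¹), up_inv_mul uX,
        Matrix.one_mul]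
    rw [add_mul, one_mul, ← ev_mul_up, this, Matrix.add_mul, ev_add, hY, add_assoc]
  rw [e1, e2, Matrix.det_mul, Matrix.det_mul]
  linear_combination (1 + P.ev (up R X⁻¹ * T * C')).det * (1 + P.ev (C' * (up R X⁻¹ * T))).det * hXY +
    h' _ hT'

/-- `det (1 + T C)` and `det (1 + C T)` are inverse to each other if `T` and `C` are odd. -/
theorem det_mul_det {T : Matrix p q R} {C : Matrix q p R} (hT : P.IsOdd T) (hC : P.IsOdd C) :
    (1 + P.ev (T * C)).det * (1 + P.ev (C * T)).det = 1 := by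
  -- Induction on `C` as a sum of matrices with one entry; `T` is quantified inside `Q` because the
  -- additive step replaces it.
  let Q : Matrix q p R → Prop := fun C => P.IsOdd C ∧
    ∀ T : Matrix p q R, P.IsOdd T → (1 + P.ev (T * C)).det * (1 + P.ev (C * T)).det = 1
  have hadd : ∀ C C', Q C → Q C' → Q (C + C') := fun C C' h h' =>
    ⟨h.1.add h'.1, det_mul_det_add h.1 h.2 h'.2⟩
  have hzero : Q 0 := ⟨fun _ _ => P.odd.zero_mem, fun T _ => by
    have h0 : P.ev (0 : Matrix p p R) = 0 := by ext; simp
    have h1 : P.ev (0 : Matrix q q R) = 0 := by ext; simp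
    rw [Matrix.mul_zero, Matrix.zero_mul, h0, h1]; simp⟩
  have hCQ : Q C := by
    rw [Matrix.matrix_eq_sum_single C]
    refine Finset.sum_induction _ Q hadd hzero fun j _ =>
      Finset.sum_induction _ Q hadd hzero fun i _ => ⟨?_, fun T hT =>
        det_mul_det_single hT j i (hC j i)⟩
    intro k l
    rw [Matrix.single_apply]
    split_ifs
    · exact hC j i
    · exact P.odd.zero_mem
  exact hCQ.2 T hT

theorem isUnit_det {T : Matrix p q R} {C : Matrix q p R} (hT : P.IsOdd T) (hC : P.IsOdd C) :
    IsUnit (1 + P.ev (T * C)).det :=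
  IsUnit.of_mul_eq_one _ (det_mul_det hT hC)

end OddPart

end Odd

/-! ### Multiplicativity of the Berezinian -/

section BerMul

variable {E : Type u} {R : Type v} [CommRing E] [Ring R] [Algebra E R] {P : OddPart E R}
variable {r s : ℕ}

theorem ber_fromBlocks (A : Matrix (Fin r) (Fin r) R) (B : Matrix (Fin r) (Fin s) R)
    (C : Matrix (Fin s) (Fin r) R) {d : Matrix (Fin s) (Fin s) E} (hd : IsUnit d.det) :
    ber (Matrix.fromBlocks A B C (up R d)) =
      colDet (A - B * up R d⁻¹ * C) * algebraMap E R (Ring.inverse d.det) := by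
  rw [ber, Matrix.toBlocks_fromBlocks₁₁, Matrix.toBlocks_fromBlocks₁₂, Matrix.toBlocks_fromBlocks₂₁,
    Matrix.toBlocks_fromBlocks₂₂, inverse_up hd, colDet_up]
  congr 1
  refine ringInverse_eq ?_ ?_
  · rw [← map_mul, Ring.mul_inverse_cancel _ hd, map_one]
  · rw [← map_mul, Ring.inverse_mul_cancel _ hd, map_one]

theorem ringInverse_unit_mul {A : Type*} [CommRing A] {x y : A} (hx : IsUnit x) (hy : IsUnit y) :
    Ring.inverse (x * y) = Ring.inverse x * Ring.inverse y :=
  ringInverse_eq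
    (by rw [mul_mul_mul_comm, Ring.mul_inverse_cancel _ hx, Ring.mul_inverse_cancel _ hy, one_mul])
    (by rw [mul_mul_mul_comm, Ring.inverse_mul_cancel _ hx, Ring.inverse_mul_cancel _ hy, one_mul])

/-- The Schur complement of an even matrix is even. -/
theorem OddPart.IsOdd.up_schur {a : Matrix (Fin r) (Fin r) E} {b : Matrix (Fin r) (Fin s) R}
    {c : Matrix (Fin s) (Fin r) R} {d : Matrix (Fin s) (Fin s) E}
    (hb : P.IsOdd b) (hc : P.IsOdd c) :
    up R (a - P.ev (b * up R d⁻¹ * c)) = up R a - b * up R d⁻¹ * c := by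
  rw [sub_eq_add_neg, sub_eq_add_neg, up_add]
  nth_rewrite 2 [← (hb.mul_up d⁻¹).up_ev hc]
  congr 1
  ext i j
  simp

theorem ber_even {a : Matrix (Fin r) (Fin r) E} {b : Matrix (Fin r) (Fin s) R}
    {c : Matrix (Fin s) (Fin r) R} {d : Matrix (Fin s) (Fin s) E}
    (hb : P.IsOdd b) (hc : P.IsOdd c) (hd : IsUnit d.det) :
    ber (Matrix.fromBlocks (up R a) b c (up R d)) =
      algebraMap E R ((a - P.ev (b * up R d⁻¹ * c)).det * Ring.inverse d.det) := by
  rw [ber_fromBlocks _ _ _ hd, ← hb.up_schur hc, colDet_up, map_mul]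

/-- `Ber (g M) = Ber g Ber M`. The columns of `M` in even positions are arbitrary. -/
theorem ber_mul_fromBlocks {a : Matrix (Fin r) (Fin r) E} {b : Matrix (Fin r) (Fin s) R}
    {c : Matrix (Fin s) (Fin r) R} {d : Matrix (Fin s) (Fin s) E}
    (hb : P.IsOdd b) (hc : P.IsOdd c) (hd : IsUnit d.det)
    (A : Matrix (Fin r) (Fin r) R) {B : Matrix (Fin r) (Fin s) R}
    (C : Matrix (Fin s) (Fin r) R) {D : Matrix (Fin s) (Fin s) E}
    (hB : P.IsOdd B) (hD : IsUnit D.det) :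
    BerDefined (Matrix.fromBlocks (up R a) b c (up R d) * Matrix.fromBlocks A B C (up R D)) ∧
    ber (Matrix.fromBlocks (up R a) b c (up R d) * Matrix.fromBlocks A B C (up R D)) =
      ber (Matrix.fromBlocks (up R a) b c (up R d)) * ber (Matrix.fromBlocks A B C (up R D)) := by
  -- After division by the invertible blocks `d` and `D`, the odd-odd block of the product is `d (1
  -- + G T) D`.
  set T : Matrix (Fin r) (Fin s) R := B * up R D⁻¹ with hTdef
  set G : Matrix (Fin s) (Fin r) R := up R d⁻¹ * c with hGdef
  have hT : P.IsOdd T := hB.mul_up _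
  have hG : P.IsOdd G := hc.up_mul _
  set X := 1 + P.ev (T * G) with hX
  set Y := 1 + P.ev (G * T) with hY
  have hXY : X.det * Y.det = 1 := OddPart.det_mul_det hT hG
  have uX : IsUnit X.det := IsUnit.of_mul_eq_one _ hXY
  have uY : IsUnit Y.det := OddPart.isUnit_det hG hT
  have hupX : (up R X : Matrix _ _ R) = 1 + T * G := hT.up_one_add hG
  have hupY : (up R Y : Matrix _ _ R) = 1 + G * T := hG.up_one_add hT
  have hTD : T * up R D = B := by
    rw [hTdef, Matrix.mul_assoc, up_inv_mul hD, Matrix.mul_one]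
  have hdG : up R d * G = c := by
    rw [hGdef, ← Matrix.mul_assoc, up_mul_inv hd, Matrix.one_mul]
  have e22 : c * B + up R d * up R D = up R (d * Y * D) := by
    rw [up_mul, up_mul, hupY, ← hTD]
    nth_rewrite 1 [← hdG]
    simp only [Matrix.mul_add, Matrix.add_mul, Matrix.mul_assoc, Matrix.mul_one]
    abel
  have uu : IsUnit (d * Y * D).det := by
    rw [Matrix.det_mul, Matrix.det_mul]; exact (hd.mul uY).mul hD
  rw [Matrix.fromBlocks_multiply, e22]
  refine ⟨?_, ?_⟩
  · rw [BerDefined, Matrix.toBlocks_fromBlocks₂₂]; exact isUnit_up uu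
  set S : Matrix (Fin r) (Fin r) E := a - P.ev (b * up R d⁻¹ * c) with hS
  have hupS : up R S = up R a - b * G := by
    rw [hS, hb.up_schur hc, hGdef, Matrix.mul_assoc]
  have hinv : (d * Y * D)⁻¹ = D⁻¹ * (Y⁻¹ * d⁻¹) := by
    rw [Matrix.mul_inv_rev, Matrix.mul_inv_rev]
  have hTY : T * up R Y⁻¹ = up R X⁻¹ * T := by
    have h1 : up R X * T = T * up R Y := by
      rw [hupX, hupY, Matrix.mul_add, Matrix.add_mul, Matrix.mul_one, Matrix.one_mul,
        Matrix.mul_assoc]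
    calc T * up R Y⁻¹ = up R X⁻¹ * (up R X * T) * up R Y⁻¹ := by
          rw [← Matrix.mul_assoc, up_inv_mul uX, Matrix.one_mul]
      _ = up R X⁻¹ * T * (up R Y * up R Y⁻¹) := by
          rw [h1]; simp only [Matrix.mul_assoc]
      _ = _ := by rw [up_mul_inv uY, Matrix.mul_one]
  -- The Schur complement of the product is `S X⁻¹` times that of the second factor, with `S` the
  -- Schur complement of the first. The extra `det X⁻¹` is compensated by `det Y` in the
  -- denominator, since `det X · det Y = 1`.
  have eS : up R a * A + b * C - (up R a * B + b * up R D) * up R (d * Y * D)⁻¹ * (c * A + up R d * C) =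
      up R (S * X⁻¹) * (A - B * up R D⁻¹ * C) := by
    have hL : (up R a * B + b * up R D) * up R (d * Y * D)⁻¹ * (c * A + up R d * C) =
        (up R S * up R X⁻¹ * T + b) * (G * A + C) := by
      have h1 : up R a * B + b * up R D = (up R S * T + b * up R Y) * up R D := by
        rw [hupS, hupY, Matrix.add_mul, Matrix.mul_assoc _ T, hTD, Matrix.sub_mul, Matrix.mul_add,
          Matrix.add_mul, Matrix.mul_one, Matrix.mul_assoc b (G * T), Matrix.mul_assoc G, hTD,
          Matrix.mul_assoc]
        abel
      have h2 : c * A + up R d * C = up R d * (G * A + C) := by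
        rw [Matrix.mul_add, ← Matrix.mul_assoc, hdG]
      have h3 : up R D * up R (d * Y * D)⁻¹ * up R d = (up R Y⁻¹ : Matrix _ _ R) := by
        rw [hinv, ← up_mul, ← up_mul, ← Matrix.mul_assoc D, Matrix.mul_nonsing_inv _ hD,
          Matrix.one_mul, Matrix.mul_assoc, Matrix.nonsing_inv_mul _ hd, Matrix.mul_one]
      calc _ = (up R S * T + b * up R Y) * (up R D * up R (d * Y * D)⁻¹ * up R d) * (G * A + C) := by
            rw [h1, h2]; simp only [Matrix.mul_assoc]
        _ = _ := by
            rw [h3, Matrix.add_mul _ _ (up R Y⁻¹), Matrix.mul_assoc b, up_mul_inv uY, Matrix.mul_one,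
              Matrix.mul_assoc _ T, hTY, ← Matrix.mul_assoc]
    have ha : up R a = up R S * up R X⁻¹ * (1 + T * G) + b * G := by
      rw [← hupX, Matrix.mul_assoc, up_inv_mul uX, Matrix.mul_one, hupS]; abel
    rw [hL, ← hTdef, up_mul, ha]
    simp only [Matrix.mul_add, Matrix.add_mul, Matrix.mul_sub, Matrix.mul_assoc, Matrix.mul_one]
    abel
  rw [ber_fromBlocks _ _ _ uu, ber_even hb hc hd, ber_fromBlocks _ _ _ hD, eS, colDet_up_mul,
    ← Algebra.commutes, ← Algebra.commutes (Ring.inverse D.det), ← mul_assoc, ← mul_assoc, ← map_mul,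
    ← map_mul]
  congr 2
  rw [Matrix.det_mul S, Matrix.det_nonsing_inv, Matrix.det_mul, Matrix.det_mul,
    ringInverse_unit_mul (hd.mul uY) hD, ringInverse_unit_mul hd uY]
  have hi : Ring.inverse X.det * Ring.inverse Y.det = 1 := by
    rw [← ringInverse_unit_mul uX uY, hXY, Ring.inverse_one]
  linear_combination Ring.inverse d.det * Ring.inverse D.det * S.det * hi

theorem parityRev_fromBlocks (A : Matrix (Fin r) (Fin r) R) (B : Matrix (Fin r) (Fin s) R)
    (C : Matrix (Fin s) (Fin r) R) (D : Matrix (Fin s) (Fin s) R) :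
    parityRev (Matrix.fromBlocks A B C D) = Matrix.fromBlocks D C B A :=
  Matrix.fromBlocks_submatrix_sum_swap_sum_swap A B C D

/-- With `T = -a⁻¹ b` and `G = d⁻¹ c`, the two Schur complements are `a (1 + T G)` and `d (1 + G
T)`; the factors `det a`, `det d` cancel against the denominators and `det_mul_det` does the rest.
-/
theorem ber_mul_berStar_fromBlocks {a : Matrix (Fin r) (Fin r) E} {b : Matrix (Fin r) (Fin s) R}
    {c : Matrix (Fin s) (Fin r) R} {d : Matrix (Fin s) (Fin s) E}
    (hb : P.IsOdd b) (hc : P.IsOdd c) (ha : IsUnit a.det) (hd : IsUnit d.det) :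
    ber (Matrix.fromBlocks (up R a) b c (up R d)) * berStar (Matrix.fromBlocks (up R a) b c (up R d)) =
      1 := by
  have hT : P.IsOdd (-(up R a⁻¹ * b)) := (hb.up_mul _).neg
  have hG : P.IsOdd (up R d⁻¹ * c) := hc.up_mul _
  have h1 := OddPart.det_mul_det hT hG
  rw [berStar, parityRev_fromBlocks, ber_even hb hc hd, ber_even hc hb ha, ← map_mul]
  have e1 : a - P.ev (b * up R d⁻¹ * c) = a * (1 + P.ev (-(up R a⁻¹ * b) * (up R d⁻¹ * c))) := by
    have : -(up R a⁻¹ * b) * (up R d⁻¹ * c) = up R (-a⁻¹) * (b * up R d⁻¹ * c) := by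
      have : (up R (-a⁻¹) : Matrix _ _ R) = - up R a⁻¹ := by ext; simp
      rw [this]; simp only [Matrix.neg_mul, Matrix.mul_assoc]
    rw [this, OddPart.ev_up_mul, mul_add, ← Matrix.mul_assoc, Matrix.mul_neg,
      Matrix.mul_nonsing_inv _ ha, mul_one, Matrix.neg_mul, Matrix.one_mul, sub_eq_add_neg]
  have e2 : d - P.ev (c * up R a⁻¹ * b) = d * (1 + P.ev ((up R d⁻¹ * c) * -(up R a⁻¹ * b))) := by
    have : (up R d⁻¹ * c) * -(up R a⁻¹ * b) = up R (-d⁻¹) * (c * up R a⁻¹ * b) := by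
      have : (up R (-d⁻¹) : Matrix _ _ R) = - up R d⁻¹ := by ext; simp
      rw [this]; simp only [Matrix.neg_mul, Matrix.mul_neg, Matrix.mul_assoc]
    rw [this, OddPart.ev_up_mul, mul_add, ← Matrix.mul_assoc, Matrix.mul_neg,
      Matrix.mul_nonsing_inv _ hd, mul_one, Matrix.neg_mul, Matrix.one_mul, sub_eq_add_neg]
  rw [e1, e2, Matrix.det_mul, Matrix.det_mul]
  have ia := Ring.mul_inverse_cancel _ ha
  have id := Ring.mul_inverse_cancel _ hd
  rw [← map_one (algebraMap E R)]
  congr 1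
  linear_combination a.det * Ring.inverse a.det * d.det * Ring.inverse d.det * h1 +
    d.det * Ring.inverse d.det * ia + id

/-- Once the diagonal part is split off, the matrix with unit diagonal blocks and antidiagonal `p`,
`q` is multiplied by the one with `-p`, `-q`: in either order the result is block diagonal with
blocks `1 - p q` and `1 - q p`, both invertible. -/
theorem isUnit_fromBlocks {a : Matrix (Fin r) (Fin r) E} {b : Matrix (Fin r) (Fin s) R}
    {c : Matrix (Fin s) (Fin r) R} {d : Matrix (Fin s) (Fin s) E}
    (hb : P.IsOdd b) (hc : P.IsOdd c) (ha : IsUnit a.det) (hd : IsUnit d.det) :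
    IsUnit (Matrix.fromBlocks (up R a) b c (up R d)) := by
  set p : Matrix (Fin r) (Fin s) R := b * up R d⁻¹ with hp
  set q : Matrix (Fin s) (Fin r) R := c * up R a⁻¹ with hq
  have hpo : P.IsOdd p := hb.mul_up _
  have hqo : P.IsOdd q := hc.mul_up _
  have hpd : p * up R d = b := by rw [hp, Matrix.mul_assoc, up_inv_mul hd, Matrix.mul_one]
  have hqa : q * up R a = c := by rw [hq, Matrix.mul_assoc, up_inv_mul ha, Matrix.mul_one]
  have e : Matrix.fromBlocks (up R a) b c (up R d) =
      Matrix.fromBlocks 1 p q 1 * Matrix.fromBlocks (up R a) 0 0 (up R d) := by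
    rw [Matrix.fromBlocks_multiply]; simp [hpd, hqa]
  have hdiag : ∀ (a : Matrix (Fin r) (Fin r) E) (d : Matrix (Fin s) (Fin s) E),
      IsUnit a.det → IsUnit d.det →
        IsUnit (Matrix.fromBlocks (up R a) 0 0 (up R d) : Matrix (Fin r ⊕ Fin s) (Fin r ⊕ Fin s) R) :=
    fun a d ha hd => ⟨⟨Matrix.fromBlocks (up R a) 0 0 (up R d), Matrix.fromBlocks (up R a⁻¹) 0 0 (up R d⁻¹), by
      rw [Matrix.fromBlocks_multiply]; simp [up_mul_inv ha, up_mul_inv hd], by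
      rw [Matrix.fromBlocks_multiply]; simp [up_inv_mul ha, up_inv_mul hd]⟩, rfl⟩
  have hcomm : Matrix.fromBlocks 1 p q 1 * Matrix.fromBlocks 1 (-p) (-q) 1 =
      Matrix.fromBlocks (up R (1 + P.ev (p * -q))) 0 0 (up R (1 + P.ev (q * -p))) := by
    rw [hpo.up_one_add hqo.neg, hqo.up_one_add hpo.neg, Matrix.fromBlocks_multiply]
    simp [add_comm]
  have hcomm' : Matrix.fromBlocks 1 (-p) (-q) 1 * Matrix.fromBlocks 1 p q 1 =
      Matrix.fromBlocks (up R (1 + P.ev (p * -q))) 0 0 (up R (1 + P.ev (q * -p))) := by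
    rw [hpo.up_one_add hqo.neg, hqo.up_one_add hpo.neg, Matrix.fromBlocks_multiply]
    simp [add_comm]
  have hu := hdiag _ _ (OddPart.isUnit_det hpo hqo.neg) (OddPart.isUnit_det hqo hpo.neg)
  have hc1 : Commute (Matrix.fromBlocks 1 p q 1) (Matrix.fromBlocks 1 (-p) (-q) 1) :=
    hcomm.trans hcomm'.symm
  rw [e]
  exact (hc1.isUnit_mul_iff.1 (hcomm ▸ hu)).1.mul (hdiag _ _ ha hd)

/-- Here `a h = 1 - b c`, whose determinant is a unit because `b` and `c` are odd. The equation
arises as a diagonal block of `g g' = 1`. -/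
theorem isUnit_det_of_mul_add_mul {κ ι : Type*} [Fintype κ] [DecidableEq κ] [Fintype ι]
    [DecidableEq ι] {a h : Matrix κ κ E} {b : Matrix κ ι R} {c : Matrix ι κ R} (hb : P.IsOdd b)
    (hc : P.IsOdd c) (e : up R a * up R h + b * c = 1) : IsUnit a.det := by
  have h1 : a * h = 1 + P.ev (b * -c) := by
    have h2 : up R (a * h) = 1 + b * -c := by
      rw [up_mul, ← e, Matrix.mul_neg, add_neg_cancel_right]
    have h3 := congrArg P.ev h2
    rwa [OddPart.ev_up, ← hb.up_one_add hc.neg, OddPart.ev_up] at h3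
  have h4 := OddPart.isUnit_det hb hc.neg
  rw [← h1, Matrix.det_mul] at h4
  exact isUnit_of_mul_isUnit_left h4

end BerMul

/-! ### The even part of a supercommutative algebra -/

section EvenPart

variable {K : Type u} {R : Type v} [Field K] [Ring R] [Algebra K R]
variable {𝒜 : ZMod 2 → Submodule K R} [GradedAlgebra 𝒜]

theorem even_mul_comm (h𝒜 : SuperCommutative 𝒜) {a : R} (ha : a ∈ 𝒜 0) (b : R) :
    a * b = b * a := by
  induction b using DirectSum.Decomposition.inductionOn 𝒜 with
  | zero => simp
  | homogeneous b => simpa using h𝒜 0 _ a ha _ b.2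
  | add b b' hb hb' => rw [mul_add, add_mul, hb, hb']

theorem odd_mul_anticomm (h𝒜 : SuperCommutative 𝒜) {a b : R} (ha : a ∈ 𝒜 1) (hb : b ∈ 𝒜 1) :
    a * b = -(b * a) := by
  have := h𝒜 1 1 a ha b hb
  simpa [ZMod.val_one] using this

/-- The substance of `2 ≠ 0`: odd elements square to zero, and antisymmetric coordinates vanish at a
repeated index. -/
theorem eq_zero_of_eq_neg [NeZero (2 : K)] {x : R} (h : x = -x) : x = 0 := by
  have h2 : (2 : K) • x = 0 := by
    rw [two_smul]; nth_rewrite 2 [h]; exact add_neg_cancel x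
  exact (smul_eq_zero_iff_right (NeZero.ne (2 : K))).1 h2

/-- The even part of a supercommutative algebra, a commutative ring. -/
def EvenPart (𝒜 : ZMod 2 → Submodule K R) [GradedAlgebra 𝒜] (_ : SuperCommutative 𝒜) : Type v :=
  SetLike.GradeZero.subring 𝒜

variable (h𝒜 : SuperCommutative 𝒜)

noncomputable instance : Ring (EvenPart 𝒜 h𝒜) :=
  inferInstanceAs (Ring (SetLike.GradeZero.subring 𝒜))

noncomputable instance : CommRing (EvenPart 𝒜 h𝒜) where
  mul_comm := fun a b => Subtype.ext (even_mul_comm h𝒜 a.2 b.1)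

/-- The inclusion of the even part. -/
def EvenPart.val : EvenPart 𝒜 h𝒜 →+* R := (SetLike.GradeZero.subring 𝒜).subtype

noncomputable instance : Algebra (EvenPart 𝒜 h𝒜) R :=
  (EvenPart.val h𝒜).toAlgebra' fun c x => even_mul_comm h𝒜 c.2 x

/-- An even element, regarded as an element of the even part. -/
def EvenPart.mk {x : R} (hx : x ∈ 𝒜 0) : EvenPart 𝒜 h𝒜 := ⟨x, hx⟩

theorem EvenPart.algebraMap_mk {x : R} (hx : x ∈ 𝒜 0) :
    algebraMap (EvenPart 𝒜 h𝒜) R (EvenPart.mk h𝒜 hx) = x := rfl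

theorem EvenPart.algebraMap_mem (e : EvenPart 𝒜 h𝒜) : algebraMap (EvenPart 𝒜 h𝒜) R e ∈ 𝒜 0 :=
  e.2

theorem EvenPart.algebraMap_injective : Function.Injective (algebraMap (EvenPart 𝒜 h𝒜) R) :=
  fun _ _ h => Subtype.ext h

/-- The odd part of a supercommutative algebra. -/
noncomputable def oddPart [NeZero (2 : K)] : OddPart (EvenPart 𝒜 h𝒜) R where
  odd :=
    { carrier := 𝒜 1
      add_mem' := fun ha hb => (𝒜 1).add_mem ha hb
      zero_mem' := (𝒜 1).zero_mem
      smul_mem' := fun c x hx => by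
        rw [Algebra.smul_def]
        simpa using SetLike.GradedMul.mul_mem (EvenPart.algebraMap_mem h𝒜 c) hx }
  retr :=
    { toFun := fun x => EvenPart.mk h𝒜 (DirectSum.decompose 𝒜 x 0).2
      map_add' := fun x y => EvenPart.algebraMap_injective h𝒜 (by
        simp [EvenPart.algebraMap_mk, DirectSum.decompose_add])
      map_smul' := fun c x => EvenPart.algebraMap_injective h𝒜 (by
        simp only [RingHom.id_apply, smul_eq_mul, map_mul, EvenPart.algebraMap_mk,
          Algebra.smul_def]
        exact DirectSum.coe_decompose_mul_of_left_mem_zero 𝒜 (EvenPart.algebraMap_mem h𝒜 c)) }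
  retr_algebraMap := fun e => EvenPart.algebraMap_injective h𝒜
    (DirectSum.decompose_of_mem_same 𝒜 (EvenPart.algebraMap_mem h𝒜 e))
  algebraMap_retr_mul := fun x hx y hy => by
    refine DirectSum.decompose_of_mem_same 𝒜 ?_
    have := SetLike.GradedMul.mul_mem (A := 𝒜) hx hy
    rwa [CharTwo.add_self_eq_zero] at this
  anticomm := fun x hx y hy => odd_mul_anticomm h𝒜 hx hy
  mul_self := fun x hx => eq_zero_of_eq_neg (K := K) (odd_mul_anticomm h𝒜 hx hx)

theorem exists_up {p q : Type*} {X : Matrix p q R} (hX : ∀ i j, X i j ∈ 𝒜 0) :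
    ∃ X' : Matrix p q (EvenPart 𝒜 h𝒜), X = up R X' :=
  ⟨Matrix.of fun i j => EvenPart.mk h𝒜 (hX i j), rfl⟩

variable [NeZero (2 : K)]

include h𝒜 in
-- An inverse over `R` could a priori have odd parts; since the projection to even parts is linear
-- over `E`, the projected inverse is still an inverse.
theorem isUnit_up_iff {p : Type*} [Fintype p] [DecidableEq p] {X : Matrix p p (EvenPart 𝒜 h𝒜)} :
    IsUnit (up R X) ↔ IsUnit X.det := by
  refine ⟨fun ⟨u, hu⟩ => ?_, isUnit_up⟩
  have h1 : up R X * (u⁻¹).1 = 1 := by rw [← hu, u.mul_inv]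
  have h2 := congrArg (oddPart h𝒜).ev h1
  rw [OddPart.ev_up_mul, ← up_one (E := EvenPart 𝒜 h𝒜), OddPart.ev_up] at h2
  have h3 := congrArg Matrix.det h2
  rw [Matrix.det_mul, Matrix.det_one] at h3
  exact IsUnit.of_mul_eq_one _ h3

end EvenPart

/-! ### Even supermatrices -/

section EvenMatrix

variable {K : Type u} {R : Type v} [Field K] [Ring R] [Algebra K R]
variable {𝒜 : ZMod 2 → Submodule K R}
variable {r s n m : ℕ}

@[simp] theorem labelParity_inl (i : Fin n) : labelParity (Sum.inl i : Fin n ⊕ Fin m) = 0 := rfl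

@[simp] theorem labelParity_inr (i : Fin m) : labelParity (Sum.inr i : Fin n ⊕ Fin m) = 1 := rfl

theorem labelParity_swap (i : Fin n ⊕ Fin m) : labelParity i.swap = labelParity i + 1 := by
  cases i <;> rfl

theorem labelParity_add_self (i : Fin n ⊕ Fin m) : labelParity i + labelParity i = 0 :=
  CharTwo.add_self_eq_zero _

/-- The columns in odd positions have the parity that they have in an even matrix. -/
def OddColumns (𝒜 : ZMod 2 → Submodule K R) (M : Matrix (Fin r ⊕ Fin s) (Fin r ⊕ Fin s) R) : Prop :=
  ∀ i α, M i (Sum.inr α) ∈ 𝒜 (labelParity i + 1)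

theorem IsEvenMatrix.oddColumns {M : Matrix (Fin r ⊕ Fin s) (Fin r ⊕ Fin s) R}
    (h : IsEvenMatrix 𝒜 M) : OddColumns 𝒜 M := fun i α => h i (Sum.inr α)

theorem IsEvenMatrix.rev {M : Matrix (Fin r ⊕ Fin s) (Fin r ⊕ Fin s) R}
    (h : IsEvenMatrix 𝒜 M) : IsEvenMatrix 𝒜 (parityRev M) := fun i j => by
  have e : labelParity i.swap + labelParity j.swap = labelParity i + labelParity j := by
    rw [labelParity_swap, labelParity_swap]
    linear_combination (CharTwo.add_self_eq_zero (1 : ZMod 2))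
  exact e ▸ h i.swap j.swap

theorem parityRev_mul (g M : Matrix (Fin r ⊕ Fin s) (Fin r ⊕ Fin s) R) :
    parityRev (g * M) = parityRev g * parityRev M :=
  (Matrix.submatrix_mul_equiv g M Sum.swap (Equiv.sumComm _ _) Sum.swap).symm

variable [GradedAlgebra 𝒜] (h𝒜 : SuperCommutative 𝒜) [NeZero (2 : K)]

theorem IsEvenMatrix.exists_fromBlocks {g : Matrix (Fin r ⊕ Fin s) (Fin r ⊕ Fin s) R}
    (hg : IsEvenMatrix 𝒜 g) : ∃ (a : Matrix (Fin r) (Fin r) (EvenPart 𝒜 h𝒜))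
      (b : Matrix (Fin r) (Fin s) R) (c : Matrix (Fin s) (Fin r) R)
      (d : Matrix (Fin s) (Fin s) (EvenPart 𝒜 h𝒜)),
      (oddPart h𝒜).IsOdd b ∧ (oddPart h𝒜).IsOdd c ∧ g = Matrix.fromBlocks (up R a) b c (up R d) := by
  obtain ⟨a, ha⟩ := exists_up h𝒜 (X := g.toBlocks₁₁) fun i j => hg (Sum.inl i) (Sum.inl j)
  obtain ⟨d, hd⟩ := exists_up h𝒜 (X := g.toBlocks₂₂) fun i j => hg (Sum.inr i) (Sum.inr j)
  refine ⟨a, g.toBlocks₁₂, g.toBlocks₂₁, d, fun i j => ?_, fun i j => ?_, ?_⟩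
  · exact hg (Sum.inl i) (Sum.inr j)
  · exact hg (Sum.inr i) (Sum.inl j)
  · rw [← ha, ← hd, Matrix.fromBlocks_toBlocks]

theorem OddColumns.exists_fromBlocks {M : Matrix (Fin r ⊕ Fin s) (Fin r ⊕ Fin s) R}
    (hM : OddColumns 𝒜 M) : ∃ (A : Matrix (Fin r) (Fin r) R)
      (B : Matrix (Fin r) (Fin s) R) (C : Matrix (Fin s) (Fin r) R)
      (D : Matrix (Fin s) (Fin s) (EvenPart 𝒜 h𝒜)),
      (oddPart h𝒜).IsOdd B ∧ M = Matrix.fromBlocks A B C (up R D) := by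
  obtain ⟨d, hd⟩ := exists_up h𝒜 (X := M.toBlocks₂₂) fun i j => hM (Sum.inr i) j
  refine ⟨M.toBlocks₁₁, M.toBlocks₁₂, M.toBlocks₂₁, d, fun i j => ?_, ?_⟩
  · exact hM (Sum.inl i) j
  · rw [← hd, Matrix.fromBlocks_toBlocks]

theorem berDefined_fromBlocks_iff {A : Matrix (Fin r) (Fin r) R} {B : Matrix (Fin r) (Fin s) R}
    {C : Matrix (Fin s) (Fin r) R} {D : Matrix (Fin s) (Fin s) (EvenPart 𝒜 h𝒜)} :
    BerDefined (Matrix.fromBlocks A B C (up R D)) ↔ IsUnit D.det := by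
  rw [BerDefined, Matrix.toBlocks_fromBlocks₂₂, isUnit_up_iff]

include h𝒜

/-- Multiplicativity of the Berezinian, and of its extension to matrices with wrong columns. -/
theorem ber_mul {g M : Matrix (Fin r ⊕ Fin s) (Fin r ⊕ Fin s) R} (hg : IsEvenMatrix 𝒜 g)
    (hgd : BerDefined g) (hM : OddColumns 𝒜 M) (hMd : BerDefined M) :
    BerDefined (g * M) ∧ ber (g * M) = ber g * ber M := by
  obtain ⟨a, b, c, d, hb, hc, rfl⟩ := hg.exists_fromBlocks h𝒜
  obtain ⟨A, B, C, D, hB, rfl⟩ := hM.exists_fromBlocks h𝒜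
  exact ber_mul_fromBlocks hb hc ((berDefined_fromBlocks_iff h𝒜).1 hgd) A C hB
    ((berDefined_fromBlocks_iff h𝒜).1 hMd)

/-- Multiplicativity of the inverse Berezinian. -/
theorem berStar_mul {g M : Matrix (Fin r ⊕ Fin s) (Fin r ⊕ Fin s) R} (hg : IsEvenMatrix 𝒜 g)
    (hgd : BerStarDefined g) (hM : OddColumns 𝒜 (parityRev M)) (hMd : BerStarDefined M) :
    BerStarDefined (g * M) ∧ berStar (g * M) = berStar g * berStar M := by
  rw [BerStarDefined, berStar, parityRev_mul]
  exact ber_mul h𝒜 hg.rev hgd hM hMd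

/-! ### Invertibility and existence of the two Berezinians -/

theorem isUnit_of_defined {g : Matrix (Fin r ⊕ Fin s) (Fin r ⊕ Fin s) R} (hg : IsEvenMatrix 𝒜 g)
    (h : BerDefined g) (h' : BerStarDefined g) : IsUnit g := by
  obtain ⟨a, b, c, d, hb, hc, rfl⟩ := hg.exists_fromBlocks h𝒜
  rw [BerStarDefined, parityRev_fromBlocks] at h'
  exact isUnit_fromBlocks hb hc ((berDefined_fromBlocks_iff h𝒜).1 h')
    ((berDefined_fromBlocks_iff h𝒜).1 h)

theorem berDefined_of_mul_eq_one {g h : Matrix (Fin r ⊕ Fin s) (Fin r ⊕ Fin s) R}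
    (hg : IsEvenMatrix 𝒜 g) (hh : IsEvenMatrix 𝒜 h) (e : g * h = 1) :
    BerDefined g ∧ BerStarDefined g := by
  obtain ⟨a, b, c, d, hb, hc, rfl⟩ := hg.exists_fromBlocks h𝒜
  obtain ⟨a', b', c', d', hb', hc', rfl⟩ := hh.exists_fromBlocks h𝒜
  rw [BerStarDefined, parityRev_fromBlocks, berDefined_fromBlocks_iff, berDefined_fromBlocks_iff]
  rw [Matrix.fromBlocks_multiply, ← Matrix.fromBlocks_one, Matrix.fromBlocks_inj] at e
  obtain ⟨e1, -, -, e2⟩ := e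
  rw [add_comm] at e2
  exact ⟨isUnit_det_of_mul_add_mul hc hb' e2, isUnit_det_of_mul_add_mul hb hc' e1⟩

omit h𝒜 [NeZero (2 : K)] in
-- From each entry of the inverse only the component of the correct parity is kept. Comparison of
-- graded components in `g g⁻¹ = 1` shows that this is again a right inverse, hence the inverse
-- itself.
theorem IsEvenMatrix.exists_inverse {g : Matrix (Fin r ⊕ Fin s) (Fin r ⊕ Fin s) R}
    (hg : IsEvenMatrix 𝒜 g) (hu : IsUnit g) : ∃ h, IsEvenMatrix 𝒜 h ∧ g * h = 1 ∧ h * g = 1 := by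
  obtain ⟨u, rfl⟩ := hu
  set h : Matrix (Fin r ⊕ Fin s) (Fin r ⊕ Fin s) R := Matrix.of fun j k =>
    ((DirectSum.decompose 𝒜 ((u⁻¹).1 j k) (labelParity j + labelParity k) : 𝒜 _) : R) with hh
  have h1 : u.1 * h = 1 := by
    ext i k
    have e := congrArg (fun x => ((DirectSum.decompose 𝒜 x (labelParity i + labelParity k) : 𝒜 _) : R))
      (congrFun (congrFun u.mul_inv i) k)
    simp only at e
    rw [DirectSum.decompose_of_mem_same 𝒜 (isEvenMatrix_one 𝒜 i k)] at e
    rw [← e, Matrix.mul_apply, Matrix.mul_apply, DirectSum.decompose_sum, DFinsupp.finsetSum_apply,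
      AddSubmonoidClass.coe_finsetSum]
    refine Finset.sum_congr rfl fun j _ => ?_
    have e' : labelParity i + labelParity k =
        (labelParity i + labelParity j) + (labelParity j + labelParity k) := by
      linear_combination -labelParity_add_self j
    rw [e', DirectSum.coe_decompose_mul_add_of_left_mem 𝒜 (hg i j), hh, Matrix.of_apply]
  refine ⟨h, fun j k => SetLike.coe_mem _, h1, ?_⟩
  have h2 : h = (u⁻¹).1 := by rw [← u.inv_mul_cancel_left h, h1, mul_one]
  rw [h2, u.inv_mul]

theorem IsEvenMatrix.defined_of_isUnit {g : Matrix (Fin r ⊕ Fin s) (Fin r ⊕ Fin s) R}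
    (hg : IsEvenMatrix 𝒜 g) (hu : IsUnit g) : BerDefined g ∧ BerStarDefined g := by
  obtain ⟨h, hh, e, -⟩ := hg.exists_inverse hu
  exact berDefined_of_mul_eq_one h𝒜 hg hh e

theorem ber_mul_berStar {g : Matrix (Fin r ⊕ Fin s) (Fin r ⊕ Fin s) R} (hg : IsEvenMatrix 𝒜 g)
    (h : BerDefined g) (h' : BerStarDefined g) : ber g * berStar g = 1 := by
  obtain ⟨a, b, c, d, hb, hc, rfl⟩ := hg.exists_fromBlocks h𝒜
  rw [BerStarDefined, parityRev_fromBlocks] at h'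
  exact ber_mul_berStar_fromBlocks hb hc ((berDefined_fromBlocks_iff h𝒜).1 h')
    ((berDefined_fromBlocks_iff h𝒜).1 h)

/-- If the Berezinian of an even matrix is defined and invertible, so is its inverse. -/
theorem berStarDefined_of_isUnit_ber {g : Matrix (Fin r ⊕ Fin s) (Fin r ⊕ Fin s) R}
    (hg : IsEvenMatrix 𝒜 g) (h : BerDefined g) {x : R} (hx : ber g * x = 1) : BerStarDefined g := by
  obtain ⟨a, b, c, d, hb, hc, rfl⟩ := hg.exists_fromBlocks h𝒜
  have hd := (berDefined_fromBlocks_iff h𝒜).1 h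
  rw [BerStarDefined, parityRev_fromBlocks, berDefined_fromBlocks_iff]
  rw [ber_even hb hc hd] at hx
  set S := a - (oddPart h𝒜).ev (b * up R d⁻¹ * c) with hS
  have h1 := congrArg (oddPart h𝒜).retr hx
  rw [← Algebra.smul_def, map_smul, ← map_one (algebraMap (EvenPart 𝒜 h𝒜) R),
    OddPart.retr_algebraMap, smul_eq_mul, mul_assoc] at h1
  have uS : IsUnit S.det := IsUnit.of_mul_eq_one _ h1
  -- `Ber g = det S / det d` is invertible, hence so is `S`. Multiplying `a = S + b d⁻¹ c` by `S⁻¹`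
  -- gives `a S⁻¹` plus a product of odd matrices equal to `1`.
  have e : up R a = up R S + b * (up R d⁻¹ * c) := by
    rw [hS, hb.up_schur hc, Matrix.mul_assoc, sub_add_cancel]
  have e' : up R a * up R S⁻¹ + b * -(up R d⁻¹ * c * up R S⁻¹) = 1 := by
    rw [e, Matrix.add_mul, up_mul_inv uS, Matrix.mul_neg, Matrix.mul_assoc, add_neg_cancel_right]
  exact isUnit_det_of_mul_add_mul hb ((hc.up_mul _).mul_up _).neg e'

theorem ber_one : ber (1 : Matrix (Fin r ⊕ Fin s) (Fin r ⊕ Fin s) R) = 1 := by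
  have h1 : (1 : Matrix (Fin r ⊕ Fin s) (Fin r ⊕ Fin s) R) = Matrix.fromBlocks
      (up R (1 : Matrix _ _ (EvenPart 𝒜 h𝒜))) 0 0 (up R (1 : Matrix _ _ (EvenPart 𝒜 h𝒜))) := by
    rw [up_one, up_one, Matrix.fromBlocks_one]
  rw [h1, ber_fromBlocks _ _ _ (by simp)]
  simp [colDet_up]

end EvenMatrix

section Symmetry

variable {K : Type u} {R : Type v} [Field K] [Ring R] [Algebra K R]
variable {𝒜 : ZMod 2 → Submodule K R} [GradedAlgebra 𝒜]
variable {r s n m : ℕ}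

/-! ### Parity and symmetry of Berezinians -/

theorem mem_of_mul {a b : R} {i j k : ZMod 2} (ha : a ∈ 𝒜 i) (hb : b ∈ 𝒜 j) (h : i + j = k) :
    a * b ∈ 𝒜 k :=
  h ▸ SetLike.GradedMul.mul_mem ha hb

theorem colDet_mem {k : ℕ} {S : Matrix (Fin k) (Fin k) R} {ε : Fin k → ZMod 2}
    (h : ∀ i j, S i j ∈ 𝒜 (ε j)) : colDet S ∈ 𝒜 (∑ j, ε j) := by
  refine Submodule.sum_mem _ fun σ _ => ?_
  rw [← List.sum_ofFn]
  exact zsmul_mem (SetLike.list_prod_ofFn_mem_graded _ _ fun j => h (σ j) j) _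

variable (h𝒜 : SuperCommutative 𝒜) [NeZero (2 : K)]

theorem schur_mem {A : Matrix (Fin r) (Fin r) R} {B : Matrix (Fin r) (Fin s) R}
    {C : Matrix (Fin s) (Fin r) R} (D : Matrix (Fin s) (Fin s) (EvenPart 𝒜 h𝒜))
    (hB : (oddPart h𝒜).IsOdd B) {ε : Fin r → ZMod 2} (hA : ∀ i j, A i j ∈ 𝒜 (ε j))
    (hC : ∀ i j, C i j ∈ 𝒜 (1 + ε j)) (i j : Fin r) : (A - B * up R D * C) i j ∈ 𝒜 (ε j) := by
  rw [Matrix.sub_apply, Matrix.mul_apply]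
  refine Submodule.sub_mem _ (hA i j) (Submodule.sum_mem _ fun k _ => ?_)
  refine mem_of_mul (hB.mul_up D i k) (hC k j) ?_
  linear_combination (CharTwo.add_self_eq_zero (1 : ZMod 2))

include h𝒜

theorem ber_mem {M : Matrix (Fin r ⊕ Fin s) (Fin r ⊕ Fin s) R} (hM : OddColumns 𝒜 M)
    (hd : BerDefined M) {ε : Fin r → ZMod 2}
    (hε : ∀ i j, M i (Sum.inl j) ∈ 𝒜 (labelParity i + ε j)) : ber M ∈ 𝒜 (∑ j, ε j) := by
  obtain ⟨A, B, C, D, hB, rfl⟩ := hM.exists_fromBlocks h𝒜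
  rw [ber_fromBlocks _ _ _ ((berDefined_fromBlocks_iff h𝒜).1 hd)]
  refine mem_of_mul (colDet_mem (schur_mem h𝒜 _ hB (ε := ε) (fun i j => ?_) fun i j => ?_))
    (EvenPart.algebraMap_mem h𝒜 _) (add_zero _)
  · simpa using hε (Sum.inl i) j
  · simpa using hε (Sum.inr i) j

theorem ber_perm_even {M : Matrix (Fin r ⊕ Fin s) (Fin r ⊕ Fin s) R} (hM : OddColumns 𝒜 M)
    (hd : BerDefined M) {ε : Fin r → ZMod 2}
    (hε : ∀ i j, M i (Sum.inl j) ∈ 𝒜 (labelParity i + ε j))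
    (hone : ∀ i j, ε i ≠ 0 → ε j ≠ 0 → i = j) (σ : Equiv.Perm (Fin r)) :
    ber (M.submatrix id (Sum.map σ id)) = ((Equiv.Perm.sign σ : ℤˣ) : ℤ) • ber M := by
  obtain ⟨A, B, C, D, hB, rfl⟩ := hM.exists_fromBlocks h𝒜
  have hD := (berDefined_fromBlocks_iff h𝒜).1 hd
  have e : (Matrix.fromBlocks A B C (up R D)).submatrix id (Sum.map σ id) =
      Matrix.fromBlocks (A.submatrix id σ) B (C.submatrix id σ) (up R D) := by
    ext i j; cases i <;> cases j <;> rfl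
  have hS := schur_mem h𝒜 D⁻¹ hB (ε := ε) (A := A) (C := C)
    (fun i j => by simpa using hε (Sum.inl i) j) fun i j => by simpa using hε (Sum.inr i) j
  rw [e, ber_fromBlocks _ _ _ hD, ber_fromBlocks _ _ _ hD, ← smul_mul_assoc, ← colDet_perm]
  · rfl
  · intro i j i' j' hjj
    -- At most one column of the Schur complement is odd, so of two distinct columns one is even,
    -- hence central.
    by_cases h : ε j = 0
    · exact even_mul_comm h𝒜 (h ▸ hS i j) _
    · have h' : ε j' = 0 := by
        by_contra hne; exact hjj (hone _ _ h hne)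
      exact (even_mul_comm h𝒜 (h' ▸ hS i' j') _).symm

/-- The permutation cancels in `B D⁻¹`, so the Schur complement is unchanged; only `det D` acquires
the sign, which is its own inverse. -/
theorem ber_perm_odd {M : Matrix (Fin r ⊕ Fin s) (Fin r ⊕ Fin s) R} (hM : OddColumns 𝒜 M)
    (hd : BerDefined M) (τ : Equiv.Perm (Fin s)) :
    ber (M.submatrix id (Sum.map id τ)) = ((Equiv.Perm.sign τ : ℤˣ) : ℤ) • ber M := by
  obtain ⟨A, B, C, D, hB, rfl⟩ := hM.exists_fromBlocks h𝒜
  have hD := (berDefined_fromBlocks_iff h𝒜).1 hd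
  have e : (Matrix.fromBlocks A B C (up R D)).submatrix id (Sum.map id τ) =
      Matrix.fromBlocks A (B.submatrix id τ) C (up R (D.submatrix id τ)) := by
    ext i j; cases i <;> cases j <;> rfl
  have hdet := Matrix.det_permute' τ D
  have hs : (((Equiv.Perm.sign τ : ℤˣ) : ℤ) : EvenPart 𝒜 h𝒜) *
      (((Equiv.Perm.sign τ : ℤˣ) : ℤ) : EvenPart 𝒜 h𝒜) = 1 := by
    rw [← Int.cast_mul, ← Units.val_mul, Int.units_mul_self]; simp
  have hsu : IsUnit (((Equiv.Perm.sign τ : ℤˣ) : ℤ) : EvenPart 𝒜 h𝒜) :=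
    IsUnit.of_mul_eq_one _ hs
  have hinv : up R (D.submatrix id τ)⁻¹ = (up R D⁻¹).submatrix τ id := by
    have := Matrix.inv_submatrix_equiv D (Equiv.refl _) τ
    rw [Equiv.coe_refl] at this
    rw [this]; rfl
  rw [e, ber_fromBlocks _ _ _ (hdet ▸ hsu.mul hD), ber_fromBlocks _ _ _ hD, hinv,
    Matrix.submatrix_mul_equiv B (up R D⁻¹) id τ id, Matrix.submatrix_id_id, hdet,
    ringInverse_unit_mul hsu hD, ringInverse_eq hs hs, map_mul, map_intCast, ← mul_assoc,
    zsmul_eq_mul, (Int.cast_commute _ _).eq]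
  simp only [mul_assoc, (Int.cast_commute _ _).eq]

/-- The column `j` of the Schur complement is the column `α` of `B - B D⁻¹ D = 0`. -/
theorem ber_eq_zero_of_ghost {M : Matrix (Fin r ⊕ Fin s) (Fin r ⊕ Fin s) R} (hM : OddColumns 𝒜 M)
    (hd : BerDefined M) (j : Fin r) (α : Fin s) (h : ∀ i, M i (Sum.inl j) = M i (Sum.inr α)) :
    ber M = 0 := by
  obtain ⟨A, B, C, D, hB, rfl⟩ := hM.exists_fromBlocks h𝒜
  have hD := (berDefined_fromBlocks_iff h𝒜).1 hd
  rw [ber_fromBlocks _ _ _ hD, colDet_eq_zero_of_col j, zero_mul]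
  intro i
  have h1 : ∀ k, C k j = up R D k α := fun k => h (Sum.inr k)
  have h2 : (B * up R D⁻¹ * C) i j = (B * up R D⁻¹ * up R D) i α := by
    rw [Matrix.mul_apply, Matrix.mul_apply]
    simp only [h1]
  rw [Matrix.sub_apply, h2, Matrix.mul_assoc, up_inv_mul hD, Matrix.mul_one]
  exact sub_eq_zero.2 (h (Sum.inl i))

theorem IsEvenMatrix.ber_mem_zero {g : Matrix (Fin r ⊕ Fin s) (Fin r ⊕ Fin s) R}
    (hg : IsEvenMatrix 𝒜 g) (h : BerDefined g) : ber g ∈ 𝒜 0 := by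
  have := ber_mem h𝒜 hg.oddColumns h (ε := fun _ => 0) fun i j => hg i (Sum.inl j)
  simpa using this

theorem IsEvenMatrix.berStar_mem_zero {g : Matrix (Fin r ⊕ Fin s) (Fin r ⊕ Fin s) R}
    (hg : IsEvenMatrix 𝒜 g) (h : BerStarDefined g) : berStar g ∈ 𝒜 0 :=
  hg.rev.ber_mem_zero h𝒜 h

theorem berStar_mul_ber {g : Matrix (Fin r ⊕ Fin s) (Fin r ⊕ Fin s) R} (hg : IsEvenMatrix 𝒜 g)
    (h : BerDefined g) (h' : BerStarDefined g) : berStar g * ber g = 1 := by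
  rw [← even_mul_comm h𝒜 (hg.ber_mem_zero h𝒜 h), ber_mul_berStar h𝒜 hg h h']

/-! ### The minors of a matrix are homogeneous coordinates -/

omit h𝒜

section

omit [GradedAlgebra 𝒜] [NeZero (2 : K)]

theorem IsEvenMatrix.minor {U : Matrix (Fin r ⊕ Fin s) (Fin n ⊕ Fin m) R}
    (hU : IsEvenMatrix 𝒜 U) (a : Fin r → Fin n) (μ : Fin s → Fin m) :
    IsEvenMatrix 𝒜 (minorMatrix U a μ) := fun i x => by
  cases x with
  | inl j => exact hU i (Sum.inl (a j))
  | inr j => exact hU i (Sum.inr (μ j))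

theorem IsEvenMatrix.oddColumns_cols {U : Matrix (Fin r ⊕ Fin s) (Fin n ⊕ Fin m) R}
    (hU : IsEvenMatrix 𝒜 U) (c : Fin r → Fin n ⊕ Fin m) (μ : Fin s → Fin m) :
    OddColumns 𝒜 (cols U c (oddWord n μ).1) := fun i α => hU i (Sum.inr (μ α))

theorem IsEvenMatrix.oddColumns_parityRev_cols {U : Matrix (Fin r ⊕ Fin s) (Fin n ⊕ Fin m) R}
    (hU : IsEvenMatrix 𝒜 U) (a : Fin r → Fin n) (d : Fin s → Fin n ⊕ Fin m) :
    OddColumns 𝒜 (parityRev (cols U (evenWord m a).1 d)) := fun i j => by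
  have h := hU i.swap (Sum.inl (a j))
  rw [labelParity_swap, labelParity_inl, add_zero] at h
  exact h

theorem cols_mul (g : Matrix (Fin r ⊕ Fin s) (Fin r ⊕ Fin s) R)
    (U : Matrix (Fin r ⊕ Fin s) (Fin n ⊕ Fin m) R) (c : Fin r → Fin n ⊕ Fin m)
    (d : Fin s → Fin n ⊕ Fin m) : cols (g * U) c d = g * cols U c d := rfl

theorem isRight_of_labelParity_ne_zero {x : Fin n ⊕ Fin m} (h : labelParity x ≠ 0) :
    x.isRight := by
  cases x with
  | inl _ => exact absurd rfl h
  | inr _ => rfl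

theorem isLeft_of_labelParity_add_one {x : Fin n ⊕ Fin m} (h : labelParity x + 1 ≠ 0) :
    x.isLeft := by
  cases x with
  | inl _ => rfl
  | inr _ => exact absurd (CharTwo.add_self_eq_zero _) h

end

include h𝒜

theorem isHomogCoord_plCoord {U : Matrix (Fin r ⊕ Fin s) (Fin n ⊕ Fin m) R}
    (hU : IsEvenMatrix 𝒜 U) (hreg : IsRegular U) (a₀ : Fin r ↪ Fin n) (μ₀ : Fin s ↪ Fin m) :
    IsHomogCoord 𝒜 (plCoord U) := by
  -- Parity reversion turns the statements on `u*` into those on `u`. It shifts row parities by one,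
  -- so a label in an odd position counts with parity `+ 1`, and an even ghost becomes the odd
  -- column.
  have hpar : ∀ (a : Fin r → Fin n) (d : OddWord s n m) i α,
      parityRev (cols U (evenWord m a).1 d.1) i (Sum.inl α) ∈
        𝒜 (labelParity i + (labelParity (d.1 α) + 1)) := by
    intro a d i α
    have h := hU i.swap (d.1 α)
    rw [labelParity_swap, add_assoc, add_comm 1] at h
    exact h
  have hA := hU.minor a₀ μ₀
  have hd : BerDefined (minorMatrix U a₀ μ₀) := hreg.1 (evenWord m a₀) μ₀
  have hd' : BerStarDefined (minorMatrix U a₀ μ₀) := hreg.2 a₀ (oddWord n μ₀)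
  refine
    { u_parity := fun c μ => ber_mem h𝒜 (hU.oddColumns_cols _ _) (hreg.1 c μ)
        fun i j => hU i (c.1 j)
      u_antisymm_even := fun c μ σ => ?_
      u_antisymm_odd := fun c μ τ => ?_
      u_ghost := fun c μ i α h => ber_eq_zero_of_ghost h𝒜 (hU.oddColumns_cols _ _) (hreg.1 c μ) i α
        fun k => congrArg (U k) h
      us_parity := fun a d => ber_mem h𝒜 (hU.oddColumns_parityRev_cols _ _) (hreg.2 a d) (hpar a d)
      us_antisymm_even := fun a d σ => ?_
      us_antisymm_odd := fun a d τ => ?_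
      us_ghost := fun a d α i h => ber_eq_zero_of_ghost h𝒜 (hU.oddColumns_parityRev_cols _ _)
        (hreg.2 a d) α i fun k => congrArg (U k.swap) h
      u_ne_zero := ⟨a₀, μ₀, ⟨⟨_, _, ber_mul_berStar h𝒜 hA hd hd', berStar_mul_ber h𝒜 hA hd hd'⟩, rfl⟩⟩
      us_ne_zero :=
        ⟨a₀, μ₀, ⟨⟨_, _, berStar_mul_ber h𝒜 hA hd hd', ber_mul_berStar h𝒜 hA hd hd'⟩, rfl⟩⟩ }
  · refine Eq.trans (congrArg ber ?_) (ber_perm_even h𝒜 (hU.oddColumns_cols _ _) (hreg.1 c μ)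
      (fun i j => hU i (c.1 j)) (fun i j hi hj => c.2 _ _ (isRight_of_labelParity_ne_zero hi)
        (isRight_of_labelParity_ne_zero hj)) σ)
    ext i j; cases j <;> rfl
  · refine Eq.trans (congrArg ber ?_) (ber_perm_odd h𝒜 (hU.oddColumns_cols _ _) (hreg.1 c μ) τ)
    ext i j; cases j <;> rfl
  · refine Eq.trans (congrArg ber ?_) (ber_perm_odd h𝒜 (hU.oddColumns_parityRev_cols _ _)
      (hreg.2 a d) σ)
    ext i j; cases j <;> rfl
  · refine Eq.trans (congrArg ber ?_) (ber_perm_even h𝒜 (hU.oddColumns_parityRev_cols _ _)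
      (hreg.2 a d) (hpar a d) (fun i j hi hj => d.2 _ _ (isLeft_of_labelParity_add_one hi)
        (isLeft_of_labelParity_add_one hj)) τ)
    ext i j; cases j <;> rfl

/-! ### The super Plücker map is well defined -/

theorem existsUnique_isPl {L : Grassmannian r s n m 𝒜} (hL : InDomain L) :
    ∃! p : Pfin r s n m 𝒜, IsPl L p := by
  obtain ⟨U, rfl, hreg⟩ := hL
  obtain ⟨a₀, μ₀, -⟩ := U.2.2
  refine ⟨Quotient.mk _ ⟨_, isHomogCoord_plCoord h𝒜 U.2.1 hreg a₀ μ₀⟩,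
    ⟨U, rfl, hreg, _, rfl, rfl⟩, ?_⟩
  rintro p ⟨U', hU', hreg', z, rfl, hz⟩
  obtain ⟨g, h, hg, hh, e1, e2, e⟩ := Quotient.exact hU'.symm
  obtain ⟨hd, hd'⟩ := berDefined_of_mul_eq_one h𝒜 hg hh e1
  refine Quotient.sound ((pfinSetoid r s n m 𝒜).symm ?_)
  refine ⟨⟨ber g, berStar g, ber_mul_berStar h𝒜 hg hd hd', berStar_mul_ber h𝒜 hg hd hd'⟩,
    hg.ber_mem_zero h𝒜 hd, hg.berStar_mem_zero h𝒜 hd', fun c μ => ?_, fun a d => ?_⟩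
  · rw [hz, e]
    exact (ber_mul h𝒜 hg hd (U.2.1.oddColumns_cols _ _) (hreg.1 c μ)).2
  · rw [hz, e]
    refine Eq.trans ?_ (even_mul_comm h𝒜 (hg.berStar_mem_zero h𝒜 hd') _)
    exact (berStar_mul h𝒜 hg hd' (U.2.1.oddColumns_parityRev_cols _ _) (hreg.2 a d)).2

end Symmetry

section Cramer

variable {K : Type u} {R : Type v} [Field K] [Ring R] [Algebra K R]
variable {𝒜 : ZMod 2 → Submodule K R} [GradedAlgebra 𝒜]
variable {r s n m : ℕ}

/-! ### The super Cramer rule -/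

/-- The super Cramer rule for a normalized matrix: the blocks `M₀₁ = 0` and `M₁₁ = 1` are untouched,
and what remains is the determinant of the identity with column `i` replaced. -/
theorem ber_cols_evenSubst {W : Matrix (Fin r ⊕ Fin s) (Fin n ⊕ Fin m) R} {a : Fin r → Fin n}
    {μ : Fin s → Fin m} (hW : minorMatrix W a μ = 1) (i : Fin r) (x : Fin n ⊕ Fin m) :
    BerDefined (cols W (evenSubst a i x).1 (oddWord n μ).1) ∧
      ber (cols W (evenSubst a i x).1 (oddWord n μ).1) = W (Sum.inl i) x := by
  set M := cols W (evenSubst a i x).1 (oddWord n μ).1 with hM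
  have h22 : M.toBlocks₂₂ = 1 := by
    rw [← Matrix.toBlocks_fromBlocks₂₂ (1 : Matrix (Fin r) (Fin r) R) 0 0 1, Matrix.fromBlocks_one,
      ← hW]
    rfl
  have h12 : M.toBlocks₁₂ = 0 := by
    rw [← Matrix.toBlocks_fromBlocks₁₂ (1 : Matrix (Fin r) (Fin r) R) 0 0
      (1 : Matrix (Fin s) (Fin s) R), Matrix.fromBlocks_one, ← hW]
    rfl
  have h11 : M.toBlocks₁₁ = (1 : Matrix (Fin r) (Fin r) R).updateCol i
      fun k => W (Sum.inl k) x := by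
    ext k j
    by_cases hj : j = i
    · rw [hj, Matrix.updateCol_self]
      simp only [hM, cols, evenSubst, Matrix.toBlocks₁₁, Matrix.of_apply, Matrix.submatrix_apply,
        Sum.elim_inl, Function.update_self, id]
    · have := congrFun (congrFun hW (Sum.inl k)) (Sum.inl j)
      rw [Matrix.updateCol_ne hj]
      simp only [hM, cols, evenSubst, Matrix.toBlocks₁₁, Matrix.of_apply, Matrix.submatrix_apply,
        Sum.elim_inl, Function.update_of_ne hj, id]
      refine Eq.trans this ?_
      simp [Matrix.one_apply]
  refine ⟨by rw [BerDefined, h22]; exact isUnit_one, ?_⟩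
  rw [ber, h22, h12, h11, colDet_one, Ring.inverse_one, Matrix.zero_mul, Matrix.zero_mul, sub_zero,
    colDet_updateCol_one, Ring.inverse_one, mul_one]

theorem berStar_cols_oddSubst {W : Matrix (Fin r ⊕ Fin s) (Fin n ⊕ Fin m) R} {a : Fin r → Fin n}
    {μ : Fin s → Fin m} (hW : minorMatrix W a μ = 1) (α : Fin s) (x : Fin n ⊕ Fin m) :
    BerStarDefined (cols W (evenWord m a).1 (oddSubst μ α x).1) ∧
      berStar (cols W (evenWord m a).1 (oddSubst μ α x).1) = W (Sum.inr α) x := by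
  rw [BerStarDefined, berStar]
  set M := parityRev (cols W (evenWord m a).1 (oddSubst μ α x).1) with hM
  have h22 : M.toBlocks₂₂ = 1 := by
    rw [← Matrix.toBlocks_fromBlocks₁₁ (1 : Matrix (Fin r) (Fin r) R) 0 0
      (1 : Matrix (Fin s) (Fin s) R), Matrix.fromBlocks_one, ← hW]
    rfl
  have h12 : M.toBlocks₁₂ = 0 := by
    rw [← Matrix.toBlocks_fromBlocks₂₁ (1 : Matrix (Fin r) (Fin r) R) 0 0
      (1 : Matrix (Fin s) (Fin s) R), Matrix.fromBlocks_one, ← hW]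
    rfl
  have h11 : M.toBlocks₁₁ = (1 : Matrix (Fin s) (Fin s) R).updateCol α
      fun k => W (Sum.inr k) x := by
    ext k j
    by_cases hj : j = α
    · rw [hj, Matrix.updateCol_self]
      simp only [hM, cols, oddSubst, parityRev, Matrix.toBlocks₁₁, Matrix.of_apply,
        Matrix.submatrix_apply, Sum.swap_inl, Sum.elim_inr, Function.update_self, id]
    · have := congrFun (congrFun hW (Sum.inr k)) (Sum.inr j)
      rw [Matrix.updateCol_ne hj]
      simp only [hM, cols, oddSubst, parityRev, Matrix.toBlocks₁₁, Matrix.of_apply,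
        Matrix.submatrix_apply, Sum.swap_inl, Sum.elim_inr, Function.update_of_ne hj, id]
      refine Eq.trans this ?_
      simp [Matrix.one_apply]
  refine ⟨by rw [BerDefined, h22]; exact isUnit_one, ?_⟩
  rw [ber, h22, h12, h11, colDet_one, Ring.inverse_one, Matrix.zero_mul, Matrix.zero_mul, sub_zero,
    colDet_updateCol_one, Ring.inverse_one, mul_one]

/-! ### The relations for the minors of a matrix -/

theorem unitZPow_coe (y : Rˣ) (k : ℤ) : unitZPow (y : R) k = ((y ^ k : Rˣ) : R) := by
  rw [unitZPow, dif_pos y.isUnit, IsUnit.unit_of_val_units]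

theorem zpow_mem_zero {y : Rˣ} (h : (y : R) ∈ 𝒜 0) (h' : ((y⁻¹ : Rˣ) : R) ∈ 𝒜 0) (k : ℤ) :
    ((y ^ k : Rˣ) : R) ∈ 𝒜 0 := by
  have hp : ∀ {x : R}, x ∈ 𝒜 0 → ∀ k : ℕ, x ^ k ∈ 𝒜 0 := fun hx k => by
    simpa using SetLike.pow_mem_graded k hx
  cases k with
  | ofNat k => rw [Int.ofNat_eq_natCast, zpow_natCast, Units.val_pow_eq_pow_val]; exact hp h k
  | negSucc k =>
    rw [zpow_negSucc, ← inv_pow, Units.val_pow_eq_pow_val]; exact hp h' _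

variable (h𝒜 : SuperCommutative 𝒜) [NeZero (2 : K)]

include h𝒜

theorem commute_of_mem_zero {y z : Rˣ} (h : (y : R) ∈ 𝒜 0) : Commute y z :=
  Units.ext (even_mul_comm h𝒜 h z)

/-- The block diagonal matrix with diagonal entries `y` in even rows and `y⁻¹` in odd rows. -/
theorem diagonal_spec {y : Rˣ} (h : (y : R) ∈ 𝒜 0) (h' : ((y⁻¹ : Rˣ) : R) ∈ 𝒜 0) :
    let D : Matrix (Fin r ⊕ Fin s) (Fin r ⊕ Fin s) R :=
      Matrix.fromBlocks (Matrix.diagonal fun _ => (y : R)) 0 0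
        (Matrix.diagonal fun _ => ((y⁻¹ : Rˣ) : R))
    IsEvenMatrix 𝒜 D ∧ IsUnit D ∧ ber D = ((y ^ ((r : ℤ) + s) : Rˣ) : R) := by
  set e : EvenPart 𝒜 h𝒜 := EvenPart.mk h𝒜 h
  set f : EvenPart 𝒜 h𝒜 := EvenPart.mk h𝒜 h'
  have hef : e * f = 1 := EvenPart.algebraMap_injective h𝒜 (by
    rw [map_mul, map_one]; exact y.mul_inv)
  have hfe : f * e = 1 := by rw [mul_comm, hef]
  have hup : ∀ {k : ℕ} (g : EvenPart 𝒜 h𝒜) (z : R), algebraMap _ R g = z →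
      (Matrix.diagonal fun _ : Fin k => z) = up R (Matrix.diagonal fun _ : Fin k => g) := by
    rintro k g z rfl
    ext i j
    by_cases hij : i = j
    · subst hij; simp
    · simp [Matrix.diagonal_apply_ne _ hij]
  have hf : IsUnit (Matrix.diagonal fun _ : Fin s => f).det := by
    rw [Matrix.det_diagonal, Finset.prod_const]; exact (IsUnit.of_mul_eq_one _ hfe).pow _
  refine ⟨?_, ?_, ?_⟩
  · rintro (i | i) (j | j)
    · by_cases hij : i = j
      · subst hij; simpa using h
      · simp [Matrix.diagonal_apply_ne _ hij]
    · simp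
    · simp
    · have e11 : (1 : ZMod 2) + 1 = 0 := rfl
      by_cases hij : i = j
      · subst hij; simpa [e11] using h'
      · simp [Matrix.diagonal_apply_ne _ hij]
  · refine ⟨⟨Matrix.fromBlocks (Matrix.diagonal fun _ => (y : R)) 0 0
        (Matrix.diagonal fun _ => ((y⁻¹ : Rˣ) : R)),
      Matrix.fromBlocks (Matrix.diagonal fun _ => ((y⁻¹ : Rˣ) : R)) 0 0
        (Matrix.diagonal fun _ => (y : R)), ?_, ?_⟩, rfl⟩
    · rw [Matrix.fromBlocks_multiply]; simp
    · rw [Matrix.fromBlocks_multiply]; simp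
  · have hdf : (Matrix.diagonal fun _ : Fin s => f).det = f ^ s := by simp
    rw [hup e (y : R) rfl, hup f ((y⁻¹ : Rˣ) : R) rfl, ber_fromBlocks _ _ _ hf, Matrix.zero_mul, Matrix.zero_mul, sub_zero,
      colDet_up, ← map_mul, hdf, ringInverse_eq (x := f ^ s) (y := e ^ s)
      (by rw [← mul_pow, hfe, one_pow]) (by rw [← mul_pow, hef, one_pow])]
    simp only [Matrix.det_diagonal, Finset.prod_const, Finset.card_univ, Fintype.card_fin]
    rw [← pow_add, map_pow, ← Nat.cast_add, zpow_natCast, Units.val_pow_eq_pow_val]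
    rfl

/-- The matrix of essential coordinates of `U`, up to the rescaling by `l`, is `G U`, where the
Berezinian of `G` is the factor in the super Plücker relations. -/
theorem exists_essMatrix_eq {U : Matrix (Fin r ⊕ Fin s) (Fin n ⊕ Fin m) R}
    (hU : IsEvenMatrix 𝒜 U) {a : Fin r ↪ Fin n} {μ : Fin s ↪ Fin m}
    (hA : IsUnit (minorMatrix U a μ)) {l : Rˣ} (hl : (l : R) ∈ 𝒜 0) (hl' : ((l⁻¹ : Rˣ) : R) ∈ 𝒜 0)
    {z : EssFamily r s n m R} (hu : ∀ c μ, z.u c μ = (l : R) * (plCoord U).u c μ)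
    (hus : ∀ a d, z.us a d = (plCoord U).us a d * ((l⁻¹ : Rˣ) : R)) :
    ∃ y : Rˣ, (y : R) ∈ 𝒜 0 ∧ z.u (evenWord m a) μ = y ∧ z.us a (oddWord n μ) = (y⁻¹ : Rˣ) ∧
      ∃ G : Matrix (Fin r ⊕ Fin s) (Fin r ⊕ Fin s) R, IsEvenMatrix 𝒜 G ∧
        BerDefined G ∧ BerStarDefined G ∧ essMatrix z a μ = G * U ∧
        ber G = ((y ^ ((r : ℤ) + s - 1) : Rˣ) : R) * (l : R) ∧
        berStar G = ((y ^ (-(r : ℤ) - s + 1) : Rˣ) : R) * ((l⁻¹ : Rˣ) : R) := by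
  set A := minorMatrix U a μ with hAdef
  have hAe : IsEvenMatrix 𝒜 A := hU.minor a μ
  obtain ⟨hd, hd'⟩ := hAe.defined_of_isUnit h𝒜 hA
  obtain ⟨B, hBe, hAB, hBA⟩ := hAe.exists_inverse hA
  obtain ⟨hBd, hBd'⟩ := berDefined_of_mul_eq_one h𝒜 hBe hAe hBA
  let w : Rˣ := ⟨ber A, berStar A, ber_mul_berStar h𝒜 hAe hd hd', berStar_mul_ber h𝒜 hAe hd hd'⟩
  have hw : (w : R) ∈ 𝒜 0 := hAe.ber_mem_zero h𝒜 hd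
  have hw' : ((w⁻¹ : Rˣ) : R) ∈ 𝒜 0 := hAe.berStar_mem_zero h𝒜 hd'
  have hB : ber B = ((w⁻¹ : Rˣ) : R) := by
    have h1 := (ber_mul h𝒜 hAe hd hBe.oddColumns hBd).2
    rw [hAB, ber_one h𝒜] at h1
    exact (Units.inv_eq_of_mul_eq_one_right h1.symm).symm
  -- `y` is the rescaled coordinate `u^{a|μ}`, as `w = Ber A`.
  set y : Rˣ := l * w with hy
  have hye : (y : R) ∈ 𝒜 0 := mem_of_mul hl hw rfl
  have hye' : ((y⁻¹ : Rˣ) : R) ∈ 𝒜 0 := by rw [hy, mul_inv_rev]; exact mem_of_mul hw' hl' rfl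
  refine ⟨y, hye, hu _ _, ?_, ?_⟩
  · rw [hus, hy, mul_inv_rev]; rfl
  obtain ⟨hDe, hDu, hDb⟩ := diagonal_spec (r := r) (s := s) h𝒜 hye hye'
  set D : Matrix (Fin r ⊕ Fin s) (Fin r ⊕ Fin s) R :=
    Matrix.fromBlocks (Matrix.diagonal fun _ => (y : R)) 0 0
      (Matrix.diagonal fun _ => ((y⁻¹ : Rˣ) : R)) with hD
  have hGe : IsEvenMatrix 𝒜 (D * B) := hDe.mul hBe
  have hGu : IsUnit (D * B) := hDu.mul ⟨⟨B, A, hBA, hAB⟩, rfl⟩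
  obtain ⟨hGd, hGd'⟩ := hGe.defined_of_isUnit h𝒜 hGu
  have hDd := hDe.defined_of_isUnit h𝒜 hDu
  -- `Ber D · Ber B = y^(r+s) w⁻¹`, and `w⁻¹ = y⁻¹ l`.
  have hber : ber (D * B) = ((y ^ ((r : ℤ) + s - 1) : Rˣ) : R) * (l : R) := by
    rw [(ber_mul h𝒜 hDe hDd.1 hBe.oddColumns hBd).2, hDb, hB, ← Units.val_mul, ← Units.val_mul,
      zpow_sub_one, hy, mul_inv_rev, mul_assoc, mul_assoc, inv_mul_cancel, mul_one]
  refine ⟨D * B, hGe, hGd, hGd', ?_, hber, ?_⟩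
  -- `W = A⁻¹ U` is normalized at `a|μ`. The Cramer rule and `U = A W` identify the entries of
  -- `essMatrix` with `l · Ber A · W = y W` in even rows and `y⁻¹ W` in odd rows.
  · set W := B * U with hW
    have hUW : U = A * W := by rw [hW, ← Matrix.mul_assoc, hAB, Matrix.one_mul]
    have hWe : IsEvenMatrix 𝒜 W := hBe.mul hU
    have hW1 : minorMatrix W a μ = 1 := hBA
    rw [Matrix.mul_assoc, ← hW]
    ext i x
    cases i with
    | inl i =>
      obtain ⟨h1, h2⟩ := ber_cols_evenSubst hW1 i x
      have h3 := (ber_mul h𝒜 hAe hd (hWe.oddColumns_cols _ _) h1).2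
      have e1 : essMatrix z a μ (Sum.inl i) x = (y : R) * W (Sum.inl i) x := by
        refine (hu _ _).trans ?_
        rw [← h2, hy, Units.val_mul, mul_assoc]
        refine congrArg _ (Eq.trans ?_ h3)
        rw [← cols_mul, ← hUW]
        rfl
      rw [e1, Matrix.mul_apply, Fintype.sum_sum_type]
      simp [hD, Matrix.diagonal_apply]
    | inr α =>
      obtain ⟨h1, h2⟩ := berStar_cols_oddSubst hW1 α x
      have h3 := (berStar_mul h𝒜 hAe hd' (hWe.oddColumns_parityRev_cols _ _) h1).2
      have e1 : essMatrix z a μ (Sum.inr α) x = ((y⁻¹ : Rˣ) : R) * W (Sum.inr α) x := by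
        refine (hus _ _).trans ?_
        rw [← even_mul_comm h𝒜 hl', ← h2, hy, (commute_of_mem_zero h𝒜 hl).eq, mul_inv_rev,
          Units.val_mul, mul_assoc]
        refine congrArg _ (Eq.trans ?_ h3)
        rw [← cols_mul, ← hUW]
        rfl
      rw [e1, Matrix.mul_apply, Fintype.sum_sum_type]
      simp [hD, Matrix.diagonal_apply]
  · have h1 := ber_mul_berStar h𝒜 hGe hGd hGd'
    rw [hber, ← Units.val_mul] at h1
    rw [← Units.inv_eq_of_mul_eq_one_right h1, ← Units.val_mul]
    congr 1
    rw [mul_inv_rev, ← zpow_neg, ← (commute_of_mem_zero h𝒜 (zpow_mem_zero hye hye' _)).eq]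
    congr 2
    ring

/-- The relations are multiplicativity for `G U`. Whether `Ber` is defined depends only on the
columns `ν`, and `Ber*` only on the columns `b`; a ghost sits in the other group, so the condition
on the ghost-free submatrix suffices. The factor `l` makes the result apply to any homogeneous
coordinates of the image point. -/
theorem relations_of_rescaled {U : Matrix (Fin r ⊕ Fin s) (Fin n ⊕ Fin m) R}
    (hU : IsEvenMatrix 𝒜 U) {a : Fin r ↪ Fin n} {μ : Fin s ↪ Fin m}
    (hA : IsUnit (minorMatrix U a μ)) {l : Rˣ} (hl : (l : R) ∈ 𝒜 0) (hl' : ((l⁻¹ : Rˣ) : R) ∈ 𝒜 0)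
    {z : EssFamily r s n m R} (hu : ∀ c μ, z.u c μ = (l : R) * (plCoord U).u c μ)
    (hus : ∀ a d, z.us a d = (plCoord U).us a d * ((l⁻¹ : Rˣ) : R)) :
    Rel0 z a μ ∧
      (∀ (b : Fin r → Fin n) (ν : Fin s ↪ Fin m),
        BerDefined (minorMatrix U b ν) → Rel1 z a μ b ν) ∧
      (∀ (b : Fin r → Fin n) (k : Fin r) (l : Fin m) (ν : Fin s ↪ Fin m),
        BerDefined (minorMatrix U b ν) → Rel2 z a μ b k l ν) ∧
      (∀ (b : Fin r ↪ Fin n) (ν : Fin s → Fin m) (k : Fin s) (c : Fin n),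
        BerStarDefined (minorMatrix U b ν) → Rel3 z a μ b ν k c) := by
  obtain ⟨y, hye, hy, hy', G, hGe, hGd, hGd', hG, hGb, hGs⟩ :=
    exists_essMatrix_eq h𝒜 hU hA hl hl' hu hus
  have key : ∀ (c : EvenWord r n m) (ν : Fin s ↪ Fin m),
      BerDefined (cols U c.1 (oddWord n ν).1) →
        BerDefined (cols (essMatrix z a μ) c.1 (oddWord n ν).1) ∧
        ber (cols (essMatrix z a μ) c.1 (oddWord n ν).1) =
          unitZPow (z.u (evenWord m a) μ) ((r : ℤ) + s - 1) * z.u c ν := by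
    intro c ν hd
    have h := ber_mul h𝒜 hGe hGd (hU.oddColumns_cols c.1 ν) hd
    rw [hG, cols_mul]
    refine ⟨h.1, ?_⟩
    rw [h.2, hGb, hy, unitZPow_coe, hu, mul_assoc]
    rfl
  refine ⟨?_, fun b ν hd => key _ ν hd, fun b k l ν hd => key _ ν hd, fun b ν k c hd => ?_⟩
  · rw [Rel0, hy, hy', Units.mul_inv]
  · have h := berStar_mul h𝒜 hGe hGd' (hU.oddColumns_parityRev_cols b (oddSubst ν k (Sum.inl c)).1) hd
    rw [Rel3, hG, cols_mul]
    refine ⟨h.1, ?_⟩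
    rw [h.2, hGs, hy, unitZPow_coe, hus, mul_assoc, even_mul_comm h𝒜 hl']
    rfl

/-- Regularity makes both diagonal blocks of every submatrix `a|μ` invertible, so every `a|μ` can
serve as the base of the relations. -/
theorem superPluckerRelations_of_isPl {z : PfinVec r s n m 𝒜} {L : Grassmannian r s n m 𝒜}
    (h : IsPl L (Quotient.mk _ z)) : SuperPluckerRelations z.1 := by
  obtain ⟨U, -, hreg, z', hz, hz'⟩ := h
  obtain ⟨l, hl, hl', hu, hus⟩ := Quotient.exact hz
  rw [hz'] at hu hus
  have hA : ∀ (a : Fin r ↪ Fin n) (μ : Fin s ↪ Fin m), IsUnit (minorMatrix U.1 a μ) := fun a μ =>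
    isUnit_of_defined h𝒜 (U.2.1.minor a μ) (hreg.1 (evenWord m a) μ) (hreg.2 a (oddWord n μ))
  have key := fun a μ => relations_of_rescaled h𝒜 U.2.1 (hA a μ) hl hl' hu hus
  exact
    { rel0 := fun a μ => (key a μ).1
      rel1 := fun a μ b ν => (key a μ).2.1 b ν (hreg.1 (evenWord m b) ν)
      rel2 := fun a μ b k l ν => (key a μ).2.2.1 b k l ν (hreg.1 (evenWord m b) ν)
      rel3 := fun a μ b ν k c => (key a μ).2.2.2 b ν k c (hreg.2 b (oddWord n ν)) }

end Cramer

section Converse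

variable {r s n m : ℕ}

/-! ### Words -/

/-- Brings a word to the form in which the relations are stated; `a` only supplies a value at the
position of the ghost, which is then overwritten. -/
theorem EvenWord.eq_evenWord_or_evenSubst (a : Fin r → Fin n) (c : EvenWord r n m) :
    (∃ b, c = evenWord m b) ∨ ∃ b k l, c = evenSubst b k (Sum.inr l) := by
  by_cases h : ∃ k, (c.1 k).isRight
  · obtain ⟨k, hk⟩ := h
    obtain ⟨l, hl⟩ := Sum.isRight_iff.1 hk
    refine Or.inr ⟨fun i => (c.1 i).elim id fun _ => a i, k, l, Subtype.ext (funext fun i => ?_)⟩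
    by_cases hi : i = k
    · subst hi; simp [evenSubst, hl]
    · have hl' : (c.1 i).isLeft := by
        by_contra hne
        exact hi (c.2 i k (by simpa using hne) hk)
      obtain ⟨x, hx⟩ := Sum.isLeft_iff.1 hl'
      simp [evenSubst, Function.update_of_ne hi, hx]
  · refine Or.inl ⟨fun i => (c.1 i).elim id fun _ => a i, Subtype.ext (funext fun i => ?_)⟩
    have hl' : (c.1 i).isLeft := by
      by_contra hne
      exact h ⟨i, by simpa using hne⟩
    obtain ⟨x, hx⟩ := Sum.isLeft_iff.1 hl'
    simp [evenWord, hx]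

theorem OddWord.eq_oddWord_or_oddSubst (μ : Fin s → Fin m) (d : OddWord s n m) :
    (∃ ν, d = oddWord n ν) ∨ ∃ ν k c, d = oddSubst ν k (Sum.inl c) := by
  by_cases h : ∃ k, (d.1 k).isLeft
  · obtain ⟨k, hk⟩ := h
    obtain ⟨l, hl⟩ := Sum.isLeft_iff.1 hk
    refine Or.inr ⟨fun i => (d.1 i).elim (fun _ => μ i) id, k, l, Subtype.ext (funext fun i => ?_)⟩
    by_cases hi : i = k
    · subst hi; simp [oddSubst, hl]
    · have hl' : (d.1 i).isRight := by
        by_contra hne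
        exact hi (d.2 i k (by simpa using hne) hk)
      obtain ⟨x, hx⟩ := Sum.isRight_iff.1 hl'
      simp [oddSubst, Function.update_of_ne hi, hx]
  · refine Or.inl ⟨fun i => (d.1 i).elim (fun _ => μ i) id, Subtype.ext (funext fun i => ?_)⟩
    have hl' : (d.1 i).isRight := by
      by_contra hne
      exact h ⟨i, by simpa using hne⟩
    obtain ⟨x, hx⟩ := Sum.isRight_iff.1 hl'
    simp [oddWord, hx]

theorem sum_labelParity_evenSubst (a : Fin r → Fin n) (i : Fin r) (x : Fin n ⊕ Fin m) :
    ∑ j, labelParity ((evenSubst a i x).1 j) = labelParity x := by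
  rw [Finset.sum_eq_single i]
  · simp [evenSubst]
  · intro j _ hj
    simp [evenSubst, Function.update_of_ne hj]
  · simp

theorem sum_labelParity_oddSubst (μ : Fin s → Fin m) (α : Fin s) (x : Fin n ⊕ Fin m) :
    ∑ j, (labelParity ((oddSubst μ α x).1 j) + 1) = labelParity x + 1 := by
  rw [Finset.sum_eq_single α]
  · simp [oddSubst]
  · intro j _ hj
    simpa [oddSubst, Function.update_of_ne hj] using CharTwo.add_self_eq_zero (1 : ZMod 2)
  · simp

theorem evenSubst_self (a : Fin r → Fin n) (i : Fin r) :
    evenSubst a i (Sum.inl (a i)) = evenWord m a :=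
  Subtype.ext (Function.update_eq_self i fun k => Sum.inl (a k))

theorem oddSubst_self (μ : Fin s → Fin m) (α : Fin s) :
    oddSubst μ α (Sum.inr (μ α)) = oddWord n μ :=
  Subtype.ext (Function.update_eq_self α fun k => Sum.inr (μ k))

variable {K : Type u} {R : Type v} [Field K] [Ring R] [Algebra K R]
variable {𝒜 : ZMod 2 → Submodule K R} [GradedAlgebra 𝒜] [NeZero (2 : K)]

theorem eq_zero_of_swap (K : Type u) {R : Type v} [Field K] [NeZero (2 : K)] [Ring R] [Algebra K R]
    {k : ℕ} {i j : Fin k} (hij : i ≠ j) {x : R}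
    (h : x = ((Equiv.Perm.sign (Equiv.swap i j) : ℤˣ) : ℤ) • x) : x = 0 := by
  rw [Equiv.Perm.sign_swap hij] at h
  exact eq_zero_of_eq_neg (K := K) (by simpa using h)

theorem comp_swap_eq_self {k : ℕ} {X : Type*} (f : Fin k → X) {i j : Fin k} (h : f i = f j) :
    (fun l => f (Equiv.swap i j l)) = f := by
  funext l
  exact Equiv.apply_swap_eq_self h l

theorem IsHomogCoord.u_eq_zero {z : EssFamily r s n m R} (hz : IsHomogCoord 𝒜 z)
    {c : EvenWord r n m} (μ : Fin s ↪ Fin m) {i j : Fin r} (hij : i ≠ j) (h : c.1 i = c.1 j) :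
    z.u c μ = 0 := by
  refine eq_zero_of_swap K hij ?_
  rw [← hz.u_antisymm_even]
  exact congrArg (fun c => z.u c μ) (Subtype.ext (comp_swap_eq_self c.1 h).symm)

theorem IsHomogCoord.us_eq_zero {z : EssFamily r s n m R} (hz : IsHomogCoord 𝒜 z)
    (a : Fin r ↪ Fin n) {d : OddWord s n m} {i j : Fin s} (hij : i ≠ j) (h : d.1 i = d.1 j) :
    z.us a d = 0 := by
  refine eq_zero_of_swap K hij ?_
  rw [← hz.us_antisymm_odd]
  exact congrArg (fun d => z.us a d) (Subtype.ext (comp_swap_eq_self d.1 h).symm)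

/-! ### The matrix of essential coordinates -/

theorem IsHomogCoord.isEvenMatrix_essMatrix {z : EssFamily r s n m R} (hz : IsHomogCoord 𝒜 z)
    (a : Fin r ↪ Fin n) (μ : Fin s ↪ Fin m) : IsEvenMatrix 𝒜 (essMatrix z a μ) := by
  rintro (i | α) x
  · have h := hz.u_parity (evenSubst a i x) μ
    rw [sum_labelParity_evenSubst] at h
    rw [labelParity_inl, zero_add]
    exact h
  · have h := hz.us_parity a (oddSubst μ α x)
    rw [sum_labelParity_oddSubst] at h
    rw [labelParity_inr, add_comm]
    exact h

/-- Off-diagonal entries of the diagonal blocks have a repeated index and vanish by antisymmetry; in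
the antidiagonal blocks the ghost already occurs in the other group of indices. -/
theorem IsHomogCoord.minorMatrix_essMatrix {z : EssFamily r s n m R} (hz : IsHomogCoord 𝒜 z)
    (a : Fin r ↪ Fin n) (μ : Fin s ↪ Fin m) : minorMatrix (essMatrix z a μ) a μ =
      Matrix.fromBlocks (Matrix.diagonal fun _ => z.u (evenWord m a) μ) 0 0
        (Matrix.diagonal fun _ => z.us a (oddWord n μ)) := by
  ext (i | α) (j | β)
  · change z.u (evenSubst a i (Sum.inl (a j))) μ =
      Matrix.diagonal (fun _ => z.u (evenWord m a) μ) i j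
    by_cases hij : i = j
    · subst hij
      rw [evenSubst_self, Matrix.diagonal_apply_eq]
    · rw [Matrix.diagonal_apply_ne _ hij]
      refine hz.u_eq_zero μ hij ?_
      simp [evenSubst, Function.update_of_ne (Ne.symm hij)]
  · exact hz.u_ghost (evenSubst a i (Sum.inr (μ β))) μ i β (by simp [evenSubst])
  · exact hz.us_ghost a (oddSubst μ α (Sum.inl (a j))) α j (by simp [oddSubst])
  · change z.us a (oddSubst μ α (Sum.inr (μ β))) =
      Matrix.diagonal (fun _ => z.us a (oddWord n μ)) α β
    by_cases hij : α = β
    · subst hij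
      rw [oddSubst_self, Matrix.diagonal_apply_eq]
    · rw [Matrix.diagonal_apply_ne _ hij]
      refine hz.us_eq_zero a hij ?_
      simp [oddSubst, Function.update_of_ne (Ne.symm hij)]

theorem IsHomogCoord.even_mem {z : EssFamily r s n m R} (hz : IsHomogCoord 𝒜 z)
    (a : Fin r → Fin n) (μ : Fin s ↪ Fin m) : z.u (evenWord m a) μ ∈ 𝒜 0 := by
  simpa [evenWord] using hz.u_parity (evenWord m a) μ

theorem IsHomogCoord.even_mem_star {z : EssFamily r s n m R} (hz : IsHomogCoord 𝒜 z)
    (a : Fin r ↪ Fin n) (μ : Fin s → Fin m) : z.us a (oddWord n μ) ∈ 𝒜 0 := by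
  have e : (1 : ZMod 2) + 1 = 0 := rfl
  simpa [oddWord, e] using hz.us_parity a (oddWord n μ)

/-- The plane is spanned by the rows of `essMatrix z a μ` itself; the relations with this one base
`a|μ`, and (0) at all indices, identify its minors with `z` up to rescaling. -/
theorem exists_isPl_of_relations (h𝒜 : SuperCommutative 𝒜) (z : PfinVec r s n m 𝒜)
    (hrel : SuperPluckerRelations z.1) :
    ∃ L : Grassmannian r s n m 𝒜, IsPl L (Quotient.mk _ z) := by
  obtain ⟨z, hz⟩ := z
  obtain ⟨a, μ, -⟩ := hz.u_ne_zero
  have h0 : ∀ (b : Fin r ↪ Fin n) (ν : Fin s ↪ Fin m),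
      z.u (evenWord m b) ν * z.us b (oddWord n ν) = 1 := hrel.rel0
  have hcomm : ∀ (b : Fin r ↪ Fin n) (ν : Fin s ↪ Fin m), z.us b (oddWord n ν) * z.u (evenWord m b) ν = 1 :=
    fun b ν => (even_mul_comm h𝒜 (hz.even_mem b ν) _).symm.trans (h0 b ν)
  let y : Rˣ := ⟨_, _, h0 a μ, hcomm a μ⟩
  have hye : (y : R) ∈ 𝒜 0 := hz.even_mem a μ
  have hye' : ((y⁻¹ : Rˣ) : R) ∈ 𝒜 0 := hz.even_mem_star a μ
  set M := essMatrix z a μ with hM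
  have hMe : IsEvenMatrix 𝒜 M := hz.isEvenMatrix_essMatrix a μ
  have hMu : IsUnit (minorMatrix M a μ) := by
    rw [hM, hz.minorMatrix_essMatrix]
    exact (diagonal_spec h𝒜 hye hye').2.1
  set l : Rˣ := y ^ ((r : ℤ) + s - 1) with hl
  have hle : (l : R) ∈ 𝒜 0 := zpow_mem_zero hye hye' _
  have hle' : ((l⁻¹ : Rˣ) : R) ∈ 𝒜 0 := by rw [hl, ← zpow_neg]; exact zpow_mem_zero hye hye' _
  have hlu : unitZPow (z.u (evenWord m a) μ) ((r : ℤ) + s - 1) = l := unitZPow_coe y _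
  have hlus : unitZPow (z.u (evenWord m a) μ) (-(r : ℤ) - s + 1) = (l⁻¹ : Rˣ) := by
    rw [hl, ← zpow_neg, show -((r : ℤ) + s - 1) = -(r : ℤ) - s + 1 by ring]
    exact unitZPow_coe y _
  have h1 : ∀ (b : Fin r → Fin n) (ν : Fin s ↪ Fin m), BerDefined (minorMatrix M b ν) ∧
      ber (minorMatrix M b ν) = l * z.u (evenWord m b) ν := fun b ν => by
    have := hrel.rel1 a μ b ν
    rw [Rel1, hlu] at this
    exact this
  have hinv : ∀ (b : Fin r ↪ Fin n) (ν : Fin s ↪ Fin m),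
      ber (minorMatrix M b ν) * (z.us b (oddWord n ν) * ((l⁻¹ : Rˣ) : R)) = 1 := fun b ν => by
    rw [(h1 b ν).2, mul_assoc, ← mul_assoc _ (z.us b _), h0, one_mul, l.mul_inv]
  -- The relations do not directly assert that `Ber*` of a ghost-free submatrix is defined. By (0)
  -- its `Ber` is invertible, which forces the even-even block to be invertible.
  have hstar : ∀ (b : Fin r ↪ Fin n) (ν : Fin s ↪ Fin m), BerStarDefined (minorMatrix M b ν) :=
    fun b ν => berStarDefined_of_isUnit_ber h𝒜 (hMe.minor b ν) (h1 b ν).1 (hinv b ν)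
  -- Only the odd-odd block matters for `Ber`, so `a` may stand in for any word `c`; likewise `μ`
  -- for `d`.
  have hreg : IsRegular M := ⟨fun c ν => (h1 a ν).1, fun b d => hstar b μ⟩
  have hpl := isHomogCoord_plCoord h𝒜 hMe hreg a μ
  let U : Stiefel r s n m 𝒜 := ⟨M, hMe, a, μ, hMu⟩
  refine ⟨Quotient.mk _ U, U, rfl, hreg, ⟨plCoord M, hpl⟩,
    Quotient.sound ((pfinSetoid r s n m 𝒜).symm ⟨l, hle, hle', fun c ν => ?_, fun b d => ?_⟩), rfl⟩
  · rcases c.eq_evenWord_or_evenSubst a with ⟨b, rfl⟩ | ⟨b, k, x, rfl⟩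
    · exact (h1 b ν).2
    · have := (hrel.rel2 a μ b k x ν).2
      rw [hlu] at this
      exact this
  · rcases d.eq_oddWord_or_oddSubst μ with ⟨ν, rfl⟩ | ⟨ν, k, x, rfl⟩
    -- Ghost-free `u*` are not covered by (1)–(3). For distinct indices `Ber*` and `u* l⁻¹` are both
    -- inverse to the same `Ber`; for repeated indices both sides vanish.
    · by_cases hν : Function.Injective ν
      · have h2 := hinv b ⟨ν, hν⟩
        have h3 := berStar_mul_ber h𝒜 (hMe.minor b ν) (h1 b ⟨ν, hν⟩).1 (hstar b ⟨ν, hν⟩)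
        exact left_inv_eq_right_inv h3 h2
      · rw [Function.not_injective_iff] at hν
        obtain ⟨i, j, hij, hne⟩ := hν
        have e : (oddWord n ν).1 i = (oddWord n ν).1 j := congrArg Sum.inr hij
        change (plCoord M).us b (oddWord n ν) = z.us b (oddWord n ν) * _
        rw [hpl.us_eq_zero b hne e, hz.us_eq_zero b hne e, zero_mul]
    · have := (hrel.rel3 a μ b ν k x).2
      rw [hlus, even_mul_comm h𝒜 hle'] at this
      exact this

end Converse

end SuperPlucker

theorem mainTheorem5 {K : Type*} {R : Type*} [Field K] [NeZero (2 : K)] [Ring R] [Algebra K R]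
    (𝒜 : ZMod 2 → Submodule K R) [GradedAlgebra 𝒜] (h𝒜 : SuperPlucker.SuperCommutative 𝒜)
    (r s n m : ℕ) (hr : r ≤ n) (hs : s ≤ m) :
    (∀ L : SuperPlucker.Grassmannian r s n m 𝒜, SuperPlucker.InDomain L →
      ∃! p : SuperPlucker.Pfin r s n m 𝒜, SuperPlucker.IsPl L p) ∧
    (∀ z : SuperPlucker.PfinVec r s n m 𝒜,
      (∃ L : SuperPlucker.Grassmannian r s n m 𝒜, SuperPlucker.IsPl L (Quotient.mk _ z)) ↔
        SuperPlucker.SuperPluckerRelations z.1) ∧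
    (∀ U : SuperPlucker.Stiefel r s n m 𝒜, ∀ (a : Fin r ↪ Fin n) (μ : Fin s ↪ Fin m),
      IsUnit (SuperPlucker.minorMatrix U.1 a μ) →
        SuperPlucker.Rel0 (SuperPlucker.plCoord U.1) a μ ∧
        (∀ (b : Fin r → Fin n) (ν : Fin s ↪ Fin m),
          SuperPlucker.BerDefined (SuperPlucker.minorMatrix U.1 b ν) →
            SuperPlucker.Rel1 (SuperPlucker.plCoord U.1) a μ b ν) ∧
        (∀ (b : Fin r → Fin n) (k : Fin r) (l : Fin m) (ν : Fin s ↪ Fin m),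
          SuperPlucker.BerDefined (SuperPlucker.minorMatrix U.1 b ν) →
            SuperPlucker.Rel2 (SuperPlucker.plCoord U.1) a μ b k l ν) ∧
        (∀ (b : Fin r ↪ Fin n) (ν : Fin s → Fin m) (k : Fin s) (c : Fin n),
          SuperPlucker.BerStarDefined (SuperPlucker.minorMatrix U.1 b ν) →
            SuperPlucker.Rel3 (SuperPlucker.plCoord U.1) a μ b ν k c)) := by
  refine ⟨fun L hL => SuperPlucker.existsUnique_isPl h𝒜 hL, fun z =>
    ⟨fun ⟨_, hL⟩ => SuperPlucker.superPluckerRelations_of_isPl h𝒜 hL,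
      SuperPlucker.exists_isPl_of_relations h𝒜 z⟩, fun U a μ hA => ?_⟩
  have h1 : ((1 : Rˣ) : R) ∈ 𝒜 0 := SetLike.GradedOne.one_mem
  exact SuperPlucker.relations_of_rescaled h𝒜 U.2.1 hA (l := 1) h1 (by simpa using h1)
    (by simp) (by simp)
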